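/- Let $n\ge 0$, $G=GL(n,\mathbb C)$, and let $NG$ be the simplicial manifold with $NG(p)=G^p\ni(h_1,\dots,h_p)$ and face maps $\varepsilon_0(h_1,\dots,h_p)=(h_2,\dots,h_p)$, $\varepsilon_i(h_1,\dots,h_p)=(h_1,\dots,h_ih_{i+1},\dots,h_p)$ for $0<i<p$, $\varepsilon_p(h_1,\dots,h_p)=(h_1,\dots,h_{p-1})$. Let $\Omega^k(NG)=\bigoplus_{p+q=k}\Omega^q(NG(p))$ (smooth complex-valued forms) be the total complex with differential $d'+d''$, where $d'=\sum_{i=0}^{p+1}(-1)^i\varepsilon_i^*$ and $d''=(-1)^p d$ on $\Omega^q(NG(p))$. The second Chern class in $H^4(\Omega^*(NG))$ is the Chern–Weil class $w(c_2)=[I_\Delta(c_2(\Omega))]$ defined as follows. Let $N\bar G(p)=G^{p+1}\ni(g_0,\dots,g_p)$ and $\gamma(g_0,\dots,g_p)=(g_0g_1^{-1},\dots,g_{p-1}g_p^{-1})\in NG(p)$; on $\Delta^p\times N\bar G(p)$, with barycentric coordinates $t_0,\dots,t_p$, let $\theta=\sum_i t_i\,g_i^{-1}dg_i$ and $\Omega=d\theta+\frac12[\theta,\theta]$.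 Let $c_2(X)=\left(\frac1{2\pi i}\right)^2\frac12\left((\operatorname{tr}X)^2-\operatorname{tr}X^2\right)$ be the degree $2$ part of $\det(1-X/2\pi i)$. A simplicial $4$-form on $NG$ is a sequence of smooth $4$-forms $\varphi^{(p)}$ on $\Delta^p\times NG(p)$ compatible with the face maps: $(\varepsilon^i\times\mathrm{id})^*\varphi^{(p)}=(\mathrm{id}\times\varepsilon_i)^*\varphi^{(p-1)}$ on $\Delta^{p-1}\times NG(p)$. There is exactly one such sequence with $(\mathrm{id}\times\gamma)^*\varphi^{(p)}=c_2(\Omega)$ on $\Delta^p\times N\bar G(p)$ for all $p$; it is again denoted $c_2(\Omega)$. Finally $I_\Delta$ integrates the form on $\Delta^p\times NG(p)$ over $\Delta^p$ (with $dt_1\wedge\dots\wedge dt_p$ written in front). Then the forms $$c_{1,3}=\left(\frac1{2\pi i}\right)^2\frac{-1}{6}\operatorname{tr}\left((h^{-1}dh)^3\right)\in\Omega^3(G),$$ $$c_{2,2}=\left(\frac1{2\pi i}\right)^2\left[\frac12\operatorname{tr}\left(dh_1\,dh_2\,h_2^{-1}h_1^{-1}\right)-\frac12\operatorname{tr}(h_1^{-1}dh_1)\operatorname{tr}(h_2^{-1}dh_2)\right]\in\Omega^2(G\times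 G)$$ satisfy $d''c_{1,3}=0$, $d'c_{1,3}+d''c_{2,2}=0$ and $d'c_{2,2}=0$. Thus $c_{1,3}+c_{2,2}$ is a cocycle in $\Omega^4(NG)$, and its class in $H^4(\Omega^*(NG))$ is the second Chern class: $I_\Delta(c_2(\Omega))$ is a cocycle and $[c_{1,3}+c_{2,2}]=[I_\Delta(c_2(\Omega))]$. -/

import Mathlib

noncomputable section

namespace SimplicialDeRham

open scoped ContDiff

/-! ### Differential forms on domains of a real normed space -/

section Forms

variable {E E' F F' F'' : Type*}
  [NormedAddCommGroup E] [NormedSpace ℝ E] [NormedAddCommGroup E'] [NormedSpace ℝ E']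
  [NormedAddCommGroup F] [NormedSpace ℝ F] [NormedAddCommGroup F'] [NormedSpace ℝ F']
  [NormedAddCommGroup F''] [NormedSpace ℝ F'']

/-- Alternating `q`-linear forms on the real vector space `E` with values in `F`: the possible
values at a point of an `F`-valued differential `q`-form on a domain of `E`. -/
abbrev AltForm (E F : Type*) [NormedAddCommGroup E] [NormedSpace ℝ E] [NormedAddCommGroup F]
    [NormedSpace ℝ F] (q : ℕ) := E [⋀^Fin q]→L[ℝ] F

/-- Real-linear maps `E → F`. -/
abbrev Lin (E F : Type*) [NormedAddCommGroup E] [NormedSpace ℝ E] [NormedAddCommGroup F]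
    [NormedSpace ℝ F] := E →L[ℝ] F

/-- Real-bilinear pairings `F × F' → F''`. -/
abbrev Pairing (F F' F'' : Type*) [NormedAddCommGroup F] [NormedSpace ℝ F]
    [NormedAddCommGroup F'] [NormedSpace ℝ F'] [NormedAddCommGroup F''] [NormedSpace ℝ F''] :=
  F →L[ℝ] F' →L[ℝ] F''

lemma update_castAdd {T : Type*} {k l : ℕ} (v : Fin (k + l) → T) (i : Fin k) (z : T) :
    (fun a => Function.update v (Fin.castAdd l i) z (Fin.castAdd l a)) =
        Function.update (fun a => v (Fin.castAdd l a)) i z ∧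
      (fun a => Function.update v (Fin.castAdd l i) z (Fin.natAdd k a)) =
        fun a => v (Fin.natAdd k a) :=
  ⟨Function.update_comp_eq_of_injective v (Fin.castAdd_injective k l) i z, by
    funext a
    exact Function.update_of_ne (by simp [Fin.ext_iff]; omega) _ _⟩

lemma update_natAdd {T : Type*} {k l : ℕ} (v : Fin (k + l) → T) (i : Fin l) (z : T) :
    (fun a => Function.update v (Fin.natAdd k i) z (Fin.natAdd k a)) =
        Function.update (fun a => v (Fin.natAdd k a)) i z ∧
      (fun a => Function.update v (Fin.natAdd k i) z (Fin.castAdd l a)) =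
        fun a => v (Fin.castAdd l a) :=
  ⟨Function.update_comp_eq_of_injective v (Fin.natAdd_injective l k) i z, by
    funext a
    exact Function.update_of_ne (by simp [Fin.ext_iff]; omega) _ _⟩

lemma append_update {T : Type*} {p q : ℕ} (v : Fin p → T) (w : Fin q → T) (i : Fin q) (z : T) :
    Fin.append v (Function.update w i z) =
      Function.update (Fin.append v w) (Fin.natAdd p i) z := by
  funext a
  induction a using Fin.addCases with
  | left a =>
    rw [Function.update_of_ne (by simp [Fin.ext_iff]; omega)]
    simp
  | right a => simp [Function.update_apply]

/-- The multilinear map `v ↦ B (α (v₁, …, v_k)) (β (v_{k+1}, …, v_{k+l}))`. -/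
def mulForm {k l : ℕ} (B : Pairing F F' F'') (α : AltForm E F k) (β : AltForm E F' l) :
    ContinuousMultilinearMap ℝ (fun _ : Fin (k + l) => E) F'' where
  toFun v := B (α fun i => v (Fin.castAdd l i)) (β fun j => v (Fin.natAdd k j))
  map_update_add' := by
    intro inst v i x y
    obtain rfl : inst = instDecidableEqFin _ := Subsingleton.elim _ _
    induction i using Fin.addCases with
    | left i => simp only [update_castAdd, ContinuousAlternatingMap.map_update_add, map_add,
        add_apply]
    | right i => simp only [update_natAdd, ContinuousAlternatingMap.map_update_add, map_add]
  map_update_smul' := by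
    intro inst v i c x
    obtain rfl : inst = instDecidableEqFin _ := Subsingleton.elim _ _
    induction i using Fin.addCases with
    | left i => simp only [update_castAdd, ContinuousAlternatingMap.map_update_smul, map_smul,
        smul_apply]
    | right i => simp only [update_natAdd, ContinuousAlternatingMap.map_update_smul, map_smul]
  cont := by
    have h1 : Continuous fun v : Fin (k + l) → E => α fun i => v (Fin.castAdd l i) :=
      α.cont.comp (by fun_prop)
    have h2 : Continuous fun v : Fin (k + l) → E => β fun i => v (Fin.natAdd k i) :=
      β.cont.comp (by fun_prop)
    exact (B.continuous.comp h1).clm_apply h2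

/-- The wedge product of two vector-valued forms along a bilinear pairing `B`, normalised so that
`(α ∧ β)(v₁, …, v_{k+l}) = 1/(k! l!) ∑_σ sgn σ B (α (v_{σ 1}, …)) (β (v_{σ (k+1)}, …))`;
thus `(α ∧ β)(v, w) = B (α v) (β w) - B (α w) (β v)` for two 1-forms. -/
def wedge {k l : ℕ} (B : Pairing F F' F'') (α : AltForm E F k)
    (β : AltForm E F' l) : AltForm E F'' (k + l) :=
  ((k.factorial * l.factorial : ℝ))⁻¹ •
    ContinuousMultilinearMap.alternatization (mulForm B α β)

/-- The 1-form with value the linear map `f`. -/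
def oneForm (f : Lin E F) : AltForm E F 1 :=
  ContinuousAlternatingMap.ofSubsingleton ℝ E F 0 f

/-- Insertion of the vectors `v₁, …, v_p` into the first `p` slots of a `(p + q)`-form. -/
def insertFirst {p q : ℕ} (v : Fin p → E) (α : AltForm E F (p + q)) : AltForm E F q where
  toFun w := α (Fin.append v w)
  map_update_add' := by
    intro inst w i x y
    obtain rfl : inst = instDecidableEqFin _ := Subsingleton.elim _ _
    simp only [append_update, ContinuousAlternatingMap.map_update_add]
  map_update_smul' := by
    intro inst w i c x
    obtain rfl : inst = instDecidableEqFin _ := Subsingleton.elim _ _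
    simp only [append_update, ContinuousAlternatingMap.map_update_smul]
  cont := by
    refine α.cont.comp (continuous_pi fun a => ?_)
    induction a using Fin.addCases with
    | left a => simpa using continuous_const
    | right a => simpa using continuous_apply a
  map_eq_zero_of_eq' := by
    intro w i j hw hij
    exact α.map_eq_zero_of_eq (v := Fin.append v w) (i := Fin.natAdd p i) (j := Fin.natAdd p j)
      (by simpa using hw) (by simpa using hij)

/-- `Ω^q(S)`: the smooth complex-valued `q`-forms on `S ⊆ E`. A form on `S` is recorded as a
function on `E` that vanishes off `S`, so that two forms are equal iff they agree on `S`. -/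
def Forms (S : Set E) (q : ℕ) : Submodule ℂ (E → AltForm E ℂ q) where
  carrier := {η | ContDiffOn ℝ ∞ η S ∧ ∀ x ∉ S, η x = 0}
  add_mem' := fun ha hb => ⟨ha.1.add hb.1, fun x hx => by simp [ha.2 x hx, hb.2 x hx]⟩
  zero_mem' := ⟨contDiffOn_const, fun _ _ => rfl⟩
  smul_mem' := fun c _ ha => ⟨ha.1.const_smul c, fun x hx => by simp [ha.2 x hx]⟩

/-- The pullback `f^* η`, as a form on `S`, for a map `f` that is smooth near `S`. -/
def pullback {q : ℕ} (f : E → E') (S : Set E) (η : E' → AltForm E' F q) :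
    E → AltForm E F q :=
  S.indicator fun x => (η (f x)).compContinuousLinearMap (fderiv ℝ f x)

/-- The exterior differential of a form on the open set `S`. -/
def dOn {q : ℕ} (S : Set E) (η : E → AltForm E F q) : E → AltForm E F (q + 1) :=
  S.indicator (extDeriv η)

lemma dOn_mem {S : Set E} (hS : IsOpen S) {q : ℕ} {η : E → AltForm E ℂ q}
    (hη : η ∈ Forms S q) : dOn S η ∈ Forms S (q + 1) := by
  refine ⟨ContDiffOn.congr ?_ fun x hx => Set.indicator_of_mem hx _,
    fun x hx => Set.indicator_of_notMem hx _⟩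
  exact (ContinuousAlternatingMap.alternatizeUncurryFinCLM ℝ E ℂ).contDiff.comp_contDiffOn
    (hη.1.fderiv_of_isOpen hS (m := ∞) (by simp))

/-- Alternatization as a continuous linear map. -/
def altCLM (q : ℕ) : ContinuousMultilinearMap ℝ (fun _ : Fin q => E) F →L[ℝ] AltForm E F q :=
  LinearMap.mkContinuous
    { toFun := fun f => ContinuousMultilinearMap.alternatization f
      map_add' := fun f g => map_add _ f g
      map_smul' := fun c f => by
        ext v
        simp only [ContinuousMultilinearMap.alternatization_apply_apply,
          smul_apply, ContinuousAlternatingMap.smul_apply,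
          RingHom.id_apply, Finset.smul_sum]
        exact Finset.sum_congr rfl fun σ _ => smul_comm _ _ _ }
    (Fintype.card (Equiv.Perm (Fin q))) fun f => by
      refine ContinuousAlternatingMap.opNorm_le_bound _ (by positivity) fun v => ?_
      simp only [LinearMap.coe_mk, AddHom.coe_mk,
        ContinuousMultilinearMap.alternatization_apply_apply]
      refine (norm_sum_le_of_le
        (f := fun σ : Equiv.Perm (Fin q) => Equiv.Perm.sign σ • f (v ∘ σ)) (n := fun _ => ‖f‖ * ∏ i, ‖v i‖) _ fun σ _ => ?_).trans ?_
      · have h1 : ‖Equiv.Perm.sign σ • f (v ∘ σ)‖ = ‖f (v ∘ σ)‖ := by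
          rcases Int.units_eq_one_or (Equiv.Perm.sign σ) with h | h <;> simp [h, Units.smul_def]
        rw [h1]
        refine (f.le_opNorm _).trans_eq ?_
        congr 1
        exact Equiv.prod_comp σ fun i => ‖v i‖
      · simp [mul_assoc]

lemma contDiff_compCLM (q : ℕ) :
    ContDiff ℝ ∞ fun a : (AltForm E' F q) × (E →L[ℝ] E') =>
      a.1.compContinuousLinearMap a.2 := by
  have h1 : ContDiff ℝ ∞ fun a : (AltForm E' F q) × (E →L[ℝ] E') =>
      (ContinuousMultilinearMap.compContinuousLinearMapContinuousMultilinear ℝ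
        (fun _ : Fin q => E) (fun _ => E') F (fun _ => a.2))
        (ContinuousAlternatingMap.toContinuousMultilinearMapCLM ℝ a.1) := by
    refine ContDiff.clm_apply ?_ ?_
    · exact (ContinuousMultilinearMap.contDiff _).comp (contDiff_pi.2 fun _ => contDiff_snd)
    · exact (ContinuousLinearMap.contDiff _).comp contDiff_fst
  have h2 := ((altCLM (E := E) (F := F) q).contDiff (n := ∞)).comp h1 |>.const_smul ((q.factorial : ℝ)⁻¹)
  convert h2 using 1
  funext a
  ext v
  simp [altCLM, ContinuousMultilinearMap.alternatization_apply_apply]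
  have h3 : ∀ σ : Equiv.Perm (Fin q), Equiv.Perm.sign σ • a.1 (fun i => a.2 (v (σ i))) = a.1 (fun i => a.2 (v i)) := fun σ => by
    have := a.1.toAlternatingMap.map_perm (fun i => a.2 (v i)) σ
    simp [Function.comp_def] at this
    rw [this, smul_smul, Int.units_mul_self, one_smul]
  simp [Function.comp_def, h3, Fintype.card_perm, ← Nat.cast_smul_eq_nsmul ℝ, smul_smul, Nat.factorial_ne_zero]

lemma pullback_mem {S : Set E} {S' : Set E'} (hS : IsOpen S) {f : E → E'}
    (hf : ContDiffOn ℝ ∞ f S) (hSS : Set.MapsTo f S S') {q : ℕ} {η : E' → AltForm E' ℂ q}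
    (hη : η ∈ Forms S' q) : pullback f S η ∈ Forms S q := by
  refine ⟨ContDiffOn.congr ?_ fun x hx => Set.indicator_of_mem hx _,
    fun x hx => Set.indicator_of_notMem hx _⟩
  exact (contDiff_compCLM q).comp_contDiffOn
    ((hη.1.comp hf hSS).prodMk (hf.fderiv_of_isOpen hS (m := ∞) (by simp)))

lemma pullback_zero {q : ℕ} (f : E → E') (S : Set E) :
    pullback f S (0 : E' → AltForm E' F q) = 0 := by
  funext x
  by_cases hx : x ∈ S
  · simp only [pullback, Set.indicator_of_mem hx, Pi.zero_apply]; rfl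
  · simp [pullback, hx]

lemma dOn_zero {q : ℕ} (S : Set E) : dOn S (0 : E → AltForm E F q) = 0 := by
  have h : extDeriv (0 : E → AltForm E F q) = 0 := by
    funext x
    rw [extDeriv, show (0 : E → AltForm E F q) = fun _ => 0 from rfl, fderiv_fun_const]
    exact map_zero (ContinuousAlternatingMap.alternatizeUncurryFinCLM ℝ E F)
  rw [dOn, h, Set.indicator_zero']

lemma pullback_add {q : ℕ} (f : E → E') (S : Set E) (η η' : E' → AltForm E' F q) :
    pullback f S (η + η') = pullback f S η + pullback f S η' := by
  funext x
  by_cases hx : x ∈ S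
  · simp only [pullback, Set.indicator_of_mem hx, Pi.add_apply]; rfl
  · simp [pullback, hx]

lemma pullback_smul {q : ℕ} (f : E → E') (S : Set E) (r : ℂ) (η : E' → AltForm E' ℂ q) :
    pullback f S (r • η) = r • pullback f S η := by
  funext x
  by_cases hx : x ∈ S
  · simp only [pullback, Set.indicator_of_mem hx, Pi.smul_apply]; rfl
  · simp [pullback, hx]

lemma dOn_add {S : Set E} (hS : IsOpen S) {q : ℕ} {η η' : E → AltForm E ℂ q}
    (hη : η ∈ Forms S q) (hη' : η' ∈ Forms S q) : dOn S (η + η') = dOn S η + dOn S η' := by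
  funext x
  by_cases hx : x ∈ S
  · simp only [dOn, Set.indicator_of_mem hx, Pi.add_apply]
    exact extDeriv_add
      ((hη.1.contDiffAt (hS.mem_nhds hx)).differentiableAt (by simp))
      ((hη'.1.contDiffAt (hS.mem_nhds hx)).differentiableAt (by simp))
  · simp [dOn, hx]

lemma dOn_smul {S : Set E} (hS : IsOpen S) {q : ℕ} (r : ℂ) {η : E → AltForm E ℂ q}
    (hη : η ∈ Forms S q) : dOn S (r • η) = r • dOn S η := by
  funext x
  by_cases hx : x ∈ S
  · have hd : DifferentiableAt ℝ η x :=
      (hη.1.contDiffAt (hS.mem_nhds hx)).differentiableAt (by simp)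
    simp only [dOn, Set.indicator_of_mem hx, Pi.smul_apply, extDeriv]
    have h1 : fderiv ℝ (r • η) x = r • fderiv ℝ η x := fderiv_const_smul hd r
    rw [h1]
    exact ContinuousAlternatingMap.alternatizeUncurryFin_smul r _
  · simp [dOn, hx]

end Forms

/-! ### The simplicial manifold `NG` for `G = GL(n, ℂ)` and its total de Rham complex -/

section MatrixAlgebra

open scoped Matrix.Norms.Operator

/-- The algebra of complex `n × n` matrices, as a real normed algebra (the choice of the norm is
immaterial). -/
def Mat (n : ℕ) : Type := Matrix (Fin n) (Fin n) ℂ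

/-- An element of `Mat n` as a matrix. -/
def Mat.toMatrix {n : ℕ} (X : Mat n) : Matrix (Fin n) (Fin n) ℂ := X

instance (n : ℕ) : NormedRing (Mat n) :=
  inferInstanceAs (NormedRing (Matrix (Fin n) (Fin n) ℂ))

instance (n : ℕ) : NormedAlgebra ℝ (Mat n) :=
  inferInstanceAs (NormedAlgebra ℝ (Matrix (Fin n) (Fin n) ℂ))

instance (n : ℕ) : FiniteDimensional ℝ (Mat n) :=
  inferInstanceAs (FiniteDimensional ℝ (Matrix (Fin n) (Fin n) ℂ))

instance (n : ℕ) : CompleteSpace (Mat n) := FiniteDimensional.complete ℝ (Mat n)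

end MatrixAlgebra

/-- The real vector space `M_n(ℂ)^p` of which `GL(n, ℂ)^p` is an open subset. -/
abbrev Amb (n p : ℕ) := Fin p → Mat n

/-- `GL(n, ℂ)^p`; this is `NG(p)`, and `N\bar G(p)` is `GLpow n (p + 1)`. -/
def GLpow (n p : ℕ) : Set (Amb n p) := {h | ∀ i, IsUnit (h i)}

lemma isOpen_GLpow (n p : ℕ) : IsOpen (GLpow n p) := by
  have : GLpow n p = ⋂ i, (fun h : Amb n p => h i) ⁻¹' {x | IsUnit x} := by
    ext h; simp [GLpow]
  rw [this]
  exact isOpen_iInter_of_finite fun i => Units.isOpen.preimage (continuous_apply i)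

/-- The face operators `ε_i : NG(p + 1) → NG(p)`, `0 ≤ i ≤ p + 1`:
`ε_0` drops `h_1`, `ε_i` multiplies `h_i` and `h_{i+1}`, and `ε_{p+1}` drops `h_{p+1}`
(the entry `j` of a tuple, `j = 0, 1, …`, is the factor `h_{j+1}`). -/
def face (n : ℕ) {p : ℕ} (i : Fin (p + 2)) (h : Amb n (p + 1)) : Amb n p := fun j =>
  if (j : ℕ) + 1 < i then h j.castSucc
  else if (j : ℕ) + 1 = i then h j.castSucc * h j.succ
  else h j.succ

lemma contDiff_face (n : ℕ) {p : ℕ} (i : Fin (p + 2)) : ContDiff ℝ ∞ (face n i) := by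
  refine contDiff_pi.2 fun j => ?_
  unfold face
  have h (k : Fin (p + 1)) : ContDiff ℝ ∞ fun h : Amb n (p + 1) => h k := contDiff_apply ℝ _ k
  split_ifs
  · exact h _
  · exact (h _).mul (h _)
  · exact h _

lemma mapsTo_face (n : ℕ) {p : ℕ} (i : Fin (p + 2)) :
    Set.MapsTo (face n i) (GLpow n (p + 1)) (GLpow n p) := by
  intro h hh j
  unfold face
  split_ifs
  · exact hh _
  · exact (hh _).mul (hh _)
  · exact hh _

/-- Families with a (not necessarily smooth) `q`-form on `NG(p)` for all `p` and `q`. -/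
abbrev Fam (n : ℕ) := ∀ p q : ℕ, Amb n p → AltForm (Amb n p) ℂ q

/-- `d' = ∑_i (-1)^i ε_i^*`, from `Ω^q(NG(p))` to `Ω^q(NG(p + 1))`. -/
def dPrime (n : ℕ) (c : Fam n) : Fam n
  | 0, _ => 0
  | p + 1, q => ∑ i : Fin (p + 2), (-1 : ℂ) ^ (i : ℕ) • pullback (face n i) (GLpow n (p + 1)) (c p q)

/-- `d'' = (-1)^p d`, from `Ω^q(NG(p))` to `Ω^{q+1}(NG(p))`. -/
def dSecond (n : ℕ) (c : Fam n) : Fam n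
  | _, 0 => 0
  | p, q + 1 => (-1 : ℂ) ^ p • dOn (GLpow n p) (c p q)

/-- `Ω^k(NG) = ⨁_{p+q=k} Ω^q(NG(p))`, the degree `k` part of the total complex. -/
def Cochain (n k : ℕ) : Submodule ℂ (Fam n) where
  carrier := {c | (∀ p q, c p q ∈ Forms (GLpow n p) q) ∧ ∀ p q, p + q ≠ k → c p q = 0}
  add_mem' := fun ha hb => ⟨fun p q => add_mem (ha.1 p q) (hb.1 p q), fun p q h => by
    simp [ha.2 p q h, hb.2 p q h]⟩
  zero_mem' := ⟨fun _ _ => zero_mem _, fun _ _ _ => rfl⟩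
  smul_mem' := fun r _ ha => ⟨fun p q => Submodule.smul_mem _ r (ha.1 p q), fun p q h => by
    simp [ha.2 p q h]⟩

lemma dPrime_add (n : ℕ) (c c' : Fam n) : dPrime n (c + c') = dPrime n c + dPrime n c' := by
  funext p q
  cases p with
  | zero => simp [dPrime]
  | succ p =>
    simp only [dPrime, pullback_add, Pi.add_apply, ← Finset.sum_add_distrib, ← smul_add, pullback_add]

lemma dPrime_smul (n : ℕ) (r : ℂ) (c : Fam n) : dPrime n (r • c) = r • dPrime n c := by
  funext p q
  cases p with
  | zero => simp [dPrime]
  | succ p =>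
    simp only [dPrime, Pi.smul_apply, Finset.smul_sum, pullback_smul]
    exact Finset.sum_congr rfl fun i _ => smul_comm _ _ _

lemma dSecond_add (n : ℕ) {k : ℕ} {c c' : Fam n} (hc : c ∈ Cochain n k) (hc' : c' ∈ Cochain n k) :
    dSecond n (c + c') = dSecond n c + dSecond n c' := by
  funext p q
  cases q with
  | zero => simp [dSecond]
  | succ q =>
    simp only [dSecond, Pi.add_apply, ← smul_add,
      dOn_add (isOpen_GLpow n p) (hc.1 p q) (hc'.1 p q)]

lemma dSecond_smul (n : ℕ) {k : ℕ} (r : ℂ) {c : Fam n} (hc : c ∈ Cochain n k) :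
    dSecond n (r • c) = r • dSecond n c := by
  funext p q
  cases q with
  | zero => simp [dSecond]
  | succ q =>
    simp only [dSecond, Pi.smul_apply, dOn_smul (isOpen_GLpow n p) r (hc.1 p q)]
    exact smul_comm _ _ _

lemma total_mem (n : ℕ) {k : ℕ} {c : Fam n} (hc : c ∈ Cochain n k) :
    dPrime n c + dSecond n c ∈ Cochain n (k + 1) := by
  refine add_mem ⟨fun p q => ?_, fun p q h => ?_⟩ ⟨fun p q => ?_, fun p q h => ?_⟩
  · cases p with
    | zero => exact zero_mem _
    | succ p =>
      exact sum_mem fun i _ => Submodule.smul_mem _ _ (pullback_mem (isOpen_GLpow n _)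
        (contDiff_face n i).contDiffOn (mapsTo_face n i) (hc.1 p q))
  · cases p with
    | zero => rfl
    | succ p => simp [dPrime, hc.2 p q (by omega), pullback_zero]
  · cases q with
    | zero => exact zero_mem _
    | succ q => exact Submodule.smul_mem _ _ (dOn_mem (isOpen_GLpow n p) (hc.1 p q))
  · cases q with
    | zero => rfl
    | succ q => simp [dSecond, hc.2 p q (by omega), dOn_zero]

/-- The total differential `d' + d'' : Ω^k(NG) → Ω^{k+1}(NG)`. -/
def totalD (n k : ℕ) : Cochain n k →ₗ[ℂ] Cochain n (k + 1) where
  toFun c := ⟨dPrime n c + dSecond n c, total_mem n c.2⟩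
  map_add' c c' := Subtype.ext <| by
    simp only [Submodule.coe_add, dPrime_add, dSecond_add n c.2 c'.2]
    exact add_add_add_comm _ _ _ _
  map_smul' r c := Subtype.ext <| by
    simp only [Submodule.coe_smul, dPrime_smul, dSecond_smul n r c.2, RingHom.id_apply, smul_add]

/-- The cocycles of degree `k` of the total complex. -/
def Cocycle (n k : ℕ) : Submodule ℂ (Fam n) :=
  (LinearMap.ker (totalD n k)).map (Cochain n k).subtype

/-- The coboundaries of degree `k` of the total complex. -/
def Coboundary (n : ℕ) : ℕ → Submodule ℂ (Fam n)
  | 0 => ⊥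
  | k + 1 => (LinearMap.range (totalD n k)).map (Cochain n (k + 1)).subtype

/-- `H^k(Ω^*(NG))`. -/
abbrev Cohomology (n k : ℕ) := Cocycle n k ⧸ (Coboundary n k).submoduleOf (Cocycle n k)

/-- The cohomology class of a cocycle. -/
def cohClass {n k : ℕ} {c : Fam n} (hc : c ∈ Cocycle n k) : Cohomology n k :=
  Submodule.Quotient.mk ⟨c, hc⟩

/-! ### Simplicial forms and integration over the simplices -/

/-- The standard simplex `Δ^p` in the coordinates `(t_1, …, t_p)`; `t_0 = 1 - t_1 - … - t_p`. -/
def simplex (p : ℕ) : Set (Fin p → ℝ) := {t | (∀ i, 0 ≤ t i) ∧ ∑ i, t i ≤ 1}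

/-- The barycentric coordinates `(t_0, t_1, …, t_p)`. -/
def bary {p : ℕ} (t : Fin p → ℝ) : Fin (p + 1) → ℝ := Fin.cons (1 - ∑ i, t i) t

/-- The face operators `ε^i : Δ^p → Δ^{p+1}`, inserting `0` as `i`-th barycentric coordinate. -/
def simplexFace {p : ℕ} (i : Fin (p + 2)) (t : Fin p → ℝ) : Fin (p + 1) → ℝ :=
  Fin.tail (i.insertNth (α := fun _ => ℝ) 0 (bary t))

/-- Sequences of (not necessarily smooth) `k`-forms on `Δ^p × NG(p)`, `p = 0, 1, …`. -/
abbrev SFam (n k : ℕ) := ∀ p : ℕ,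
  (Fin p → ℝ) × Amb n p → AltForm ((Fin p → ℝ) × Amb n p) ℂ k

/-- Simplicial `k`-forms on `NG`: smooth forms `φ^{(p)}` on `Δ^p × NG(p)` with
`(ε^i × id)^* φ^{(p+1)} = (id × ε_i)^* φ^{(p)}` on `Δ^p × NG(p + 1)`. -/
structure IsSimplicialForm {n k : ℕ} (φ : SFam n k) : Prop where
  smooth : ∀ p, φ p ∈ Forms (simplex p ×ˢ GLpow n p) k
  compat : ∀ (p : ℕ) (i : Fin (p + 2)),
    pullback (Prod.map (simplexFace i) id) (simplex p ×ˢ GLpow n (p + 1)) (φ (p + 1)) =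
      pullback (Prod.map id (face n i)) (simplex p ×ˢ GLpow n (p + 1)) (φ p)

/-- The map `I_Δ` from simplicial `k`-forms to `Ω^k(NG)`: its component in `Ω^q(NG(p))`,
`p + q = k`, is the integral over `Δ^p` of `φ^{(p)}`, that is, of the coefficient of
`dt_1 ∧ ⋯ ∧ dt_p` (placed in front) in `φ^{(p)}`. -/
def fiberIntegral {n k : ℕ} (φ : SFam n k) : Fam n := fun p q =>
  if hk : k = p + q then
    (GLpow n p).indicator fun h => ∫ t in simplex p,
      (insertFirst (fun i : Fin p => ((Pi.single i 1, 0) : (Fin p → ℝ) × Amb n p))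
        (hk ▸ φ p (t, h) : AltForm ((Fin p → ℝ) × Amb n p) ℂ (p + q))).compContinuousLinearMap
          (ContinuousLinearMap.inr ℝ (Fin p → ℝ) (Amb n p))
  else 0

/-! ### The canonical connection on `N\bar G → NG` and the universal Chern-Weil construction -/

/-- `γ : N\bar G(p) → NG(p)`, `(g_0, …, g_p) ↦ (g_0 g_1⁻¹, …, g_{p-1} g_p⁻¹)`. -/
def gammaMap (n p : ℕ) (g : Amb n (p + 1)) : Amb n p := fun i => g i.castSucc * Ring.inverse (g i.succ)

/-- The canonical connection `θ = t_0 θ_0 + ⋯ + t_p θ_p` on `Δ^p × N\bar G(p)`, where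
`θ_i = g_i⁻¹ dg_i` is the Maurer-Cartan form of the `i`-th factor. -/
def connection (n p : ℕ) (x : (Fin p → ℝ) × Amb n (p + 1)) :
    AltForm ((Fin p → ℝ) × Amb n (p + 1)) (Mat n) 1 :=
  ∑ i : Fin (p + 1), bary x.1 i • oneForm
    (ContinuousLinearMap.mul ℝ (Mat n) (Ring.inverse (x.2 i)) ∘L ContinuousLinearMap.proj i ∘L
      ContinuousLinearMap.snd ℝ (Fin p → ℝ) (Amb n (p + 1)))

/-- The commutator pairing on `M_n(ℂ)`, the Lie algebra of `GL(n, ℂ)`. -/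
def bracket (n : ℕ) : Pairing (Mat n) (Mat n) (Mat n) :=
  ContinuousLinearMap.mul ℝ (Mat n) - (ContinuousLinearMap.mul ℝ (Mat n)).flip

/-- The curvature `dθ + ½ [θ, θ]` on `Δ^p × N\bar G(p)`. -/
def curvature (n p : ℕ) (x : (Fin p → ℝ) × Amb n (p + 1)) :
    AltForm ((Fin p → ℝ) × Amb n (p + 1)) (Mat n) 2 :=
  extDeriv (connection n p) x + (1 / 2 : ℝ) • wedge (bracket n) (connection n p x) (connection n p x)

/-- `φ` is the simplicial form `P(Ω)` on `NG`, for a bilinear form `P` on the Lie algebra: its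
pullback under `id × γ` is the form `P(Ω ∧ Ω)` on `Δ^p × N\bar G(p)`, for all `p`. -/
def IsChernWeilForm {n : ℕ} (P : Pairing (Mat n) (Mat n) ℂ) (φ : SFam n 4) : Prop :=
  IsSimplicialForm φ ∧ ∀ p, pullback (Prod.map id (gammaMap n p)) (simplex p ×ˢ GLpow n (p + 1)) (φ p) =
    (simplex p ×ˢ GLpow n (p + 1)).indicator fun x => wedge P (curvature n p x) (curvature n p x)

/-- `x` is the class `w(P) = [I_Δ(P(Ω))]` in `H^4(Ω^*(NG))`. -/
def IsChernWeilClass {n : ℕ} (P : Pairing (Mat n) (Mat n) ℂ) (x : Cohomology n 4) : Prop :=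
  ∃ φ : SFam n 4, IsChernWeilForm P φ ∧ ∃ h : fiberIntegral φ ∈ Cocycle n 4, x = cohClass h

/-- The trace of a matrix. -/
def tr (n : ℕ) : Lin (Mat n) ℂ :=
  LinearMap.toContinuousLinearMap
    { toFun := fun X : Mat n => X.toMatrix.trace
      map_add' := fun X Y => Matrix.trace_add X.toMatrix Y.toMatrix
      map_smul' := fun r X => Matrix.trace_smul r X.toMatrix }

lemma tr_apply {n : ℕ} (X : Mat n) : tr n X = X.toMatrix.trace := rfl

lemma toMatrix_mul {n : ℕ} (X Y : Mat n) : (X * Y).toMatrix = X.toMatrix * Y.toMatrix := rfl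

/-- The second Chern polynomial, as the symmetric bilinear form
`(X, Y) ↦ (1/2πi)² · ½ (tr X tr Y - tr XY)`; see `chern2_self` for the value on the diagonal. -/
def chern2 (n : ℕ) : Pairing (Mat n) (Mat n) ℂ :=
  ((1 / (2 * Real.pi * Complex.I)) ^ 2 * (1 / 2) : ℂ) •
    ((ContinuousLinearMap.mul ℝ ℂ).bilinearComp (tr n) (tr n) -
      ContinuousLinearMap.compL ℝ (Mat n) (Mat n) ℂ (tr n) ∘L ContinuousLinearMap.mul ℝ (Mat n))

lemma chern2_apply (n : ℕ) (X Y : Mat n) : chern2 n X Y =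
    (1 / (2 * Real.pi * Complex.I)) ^ 2 * (1 / 2) * (tr n X * tr n Y - tr n (X * Y)) :=
  rfl

lemma det_pair {n : ℕ} (M : Matrix (Fin n) (Fin n) ℂ) {i j : Fin n} (hij : i ≠ j) :
    (M.submatrix (Subtype.val : ({i, j} : Finset (Fin n)) → Fin n)
      (Subtype.val : ({i, j} : Finset (Fin n)) → Fin n)).det =
      M i i * M j j - M i j * M j i := by
  let f : Fin 2 → ({i, j} : Finset (Fin n)) := ![⟨i, by simp⟩, ⟨j, by simp⟩]
  have hf : Function.Bijective f := by
    refine ⟨fun a b h => ?_, fun x => ?_⟩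
    · fin_cases a <;> fin_cases b <;> simp_all [f, Subtype.ext_iff]
    · obtain ⟨x, hx⟩ := x
      rcases Finset.mem_insert.1 hx with rfl | hx
      · exact ⟨0, rfl⟩
      · exact ⟨1, Subtype.ext (Finset.mem_singleton.1 hx).symm⟩
  rw [← Matrix.det_submatrix_equiv_self (Equiv.ofBijective f hf), Matrix.det_fin_two]
  simp [f]

lemma coeff_two_det {n : ℕ} (M : Matrix (Fin n) (Fin n) ℂ) :
    (Matrix.det (1 + (Polynomial.X : Polynomial ℂ) • M.map Polynomial.C)).coeff 2 =
      1 / 2 * (M.trace * M.trace - (M * M).trace) := by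
  have h1 : M.trace * M.trace - (M * M).trace =
      ∑ p ∈ (Finset.univ : Finset (Fin n)).offDiag,
        (M p.1 p.1 * M p.2 p.2 - M p.1 p.2 * M p.2 p.1) := by
    have h2 : M.trace * M.trace - (M * M).trace = ∑ p : Fin n × Fin n,
        (M p.1 p.1 * M p.2 p.2 - M p.1 p.2 * M p.2 p.1) := by
      simp [Matrix.trace, Matrix.mul_apply, Finset.sum_mul_sum, Fintype.sum_prod_type,
        Finset.sum_sub_distrib]
    rw [h2]
    refine (Finset.sum_subset (Finset.subset_univ _) fun p _ hp => ?_).symm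
    have : p.1 = p.2 := by simpa using hp
    rw [this]; ring
  have h3 : ∑ p ∈ (Finset.univ : Finset (Fin n)).offDiag,
        (M p.1 p.1 * M p.2 p.2 - M p.1 p.2 * M p.2 p.1) =
      ∑ s ∈ (Finset.univ : Finset (Fin n)).powersetCard 2,
        2 * (M.submatrix (Subtype.val : s → Fin n) (Subtype.val : s → Fin n)).det := by
    rw [← Finset.sum_fiberwise_of_maps_to (t := Finset.univ.powersetCard 2)
      (g := fun p : Fin n × Fin n => ({p.1, p.2} : Finset (Fin n)))]
    · refine Finset.sum_congr rfl fun s hs => ?_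
      obtain ⟨i, j, hij, rfl⟩ := Finset.card_eq_two.1 (Finset.mem_powersetCard.1 hs).2
      have h4 : Finset.univ.offDiag.filter
          (fun p : Fin n × Fin n => ({p.1, p.2} : Finset (Fin n)) = {i, j}) =
          {(i, j), (j, i)} := by
        ext ⟨a, b⟩
        simp only [Finset.mem_filter, Finset.mem_offDiag, Finset.mem_univ, true_and,
          Finset.mem_insert, Finset.mem_singleton, Prod.mk.injEq]
        constructor
        · rintro ⟨hab, h⟩
          have ha : a ∈ ({i, j} : Finset (Fin n)) := h ▸ by simp
          have hb : b ∈ ({i, j} : Finset (Fin n)) := h ▸ by simp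
          simp only [Finset.mem_insert, Finset.mem_singleton] at ha hb
          grind
        · rintro (⟨rfl, rfl⟩ | ⟨rfl, rfl⟩)
          · exact ⟨hij, rfl⟩
          · exact ⟨hij.symm, Finset.pair_comm _ _⟩
      rw [h4, Finset.sum_pair (by simp [hij]), det_pair M hij]
      ring
    · intro p hp
      simp only [Finset.mem_offDiag, Finset.mem_univ, true_and] at hp
      exact Finset.mem_powersetCard.2 ⟨Finset.subset_univ _, Finset.card_pair hp⟩
  rw [Matrix.coeff_det_one_add_X_smul_eq_sum_minors, h1, h3, ← Finset.mul_sum]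
  ring

/-- `X ↦ chern2 n X X` is the degree 2 part of the total Chern polynomial
`X ↦ det (1 - X/2πi)`, i.e. the coefficient of `T²` in `det (1 + T · (-X/2πi))`. -/
lemma chern2_self {n : ℕ} (X : Mat n) : chern2 n X X =
    (Matrix.det (1 + (Polynomial.X : Polynomial ℂ) •
      ((-(1 / (2 * Real.pi * Complex.I) : ℂ)) • X.toMatrix).map Polynomial.C)).coeff 2 := by
  rw [coeff_two_det, chern2_apply]
  simp only [tr_apply, toMatrix_mul, Matrix.trace_smul, Matrix.smul_mul, Matrix.mul_smul,
    smul_eq_mul]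
  ring

/-! ### The forms `c_{1,3}` and `c_{2,2}` -/

/-- The matrix-valued 1-form `A · dh · B` on `NG(p)`, where `dh` is the differential of the
factor with index `i = 0, …, p - 1` (that is, `h = h_{i+1}`), for given matrices `A`, `B`. -/
def mulDiff (n p : ℕ) (A : Mat n) (i : Fin p) (B : Mat n) : AltForm (Amb n p) (Mat n) 1 :=
  oneForm (ContinuousLinearMap.mulLeftRight ℝ (Mat n) A B ∘L ContinuousLinearMap.proj i)

lemma mulDiff_apply (n p : ℕ) (A : Mat n) (i : Fin p) (B : Mat n) (v : Fin 1 → Amb n p) :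
    mulDiff n p A i B v = A * v 0 i * B :=
  rfl

/-- The wedge product of matrix-valued forms, with matrix multiplication. -/
def matWedge {n p k l : ℕ} (α : AltForm (Amb n p) (Mat n) k) (β : AltForm (Amb n p) (Mat n) l) :
    AltForm (Amb n p) (Mat n) (k + l) :=
  wedge (ContinuousLinearMap.mul ℝ (Mat n)) α β

/-- The trace of a matrix-valued form. -/
def trForm {n p k : ℕ} (α : AltForm (Amb n p) (Mat n) k) : AltForm (Amb n p) ℂ k :=
  (tr n).compContinuousAlternatingMap α

/-- `c_{1,3} = (1/2πi)² (-1/6) tr (h⁻¹dh)³` on `NG(1) = G`. -/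
def c13 (n : ℕ) : Amb n 1 → AltForm (Amb n 1) ℂ 3 := (GLpow n 1).indicator fun h =>
  let μ := mulDiff n 1 (Ring.inverse (h 0)) 0 1
  ((1 / (2 * Real.pi * Complex.I)) ^ 2 * (-1 / 6) : ℂ) • trForm (matWedge (matWedge μ μ) μ)

/-- `c_{2,2} = (1/2πi)² ½ tr (dh₁ dh₂ h₂⁻¹ h₁⁻¹) - (1/2πi)² ½ tr (h₁⁻¹dh₁) tr (h₂⁻¹dh₂)` on
`NG(2) = G × G`. -/
def c22 (n : ℕ) : Amb n 2 → AltForm (Amb n 2) ℂ 2 := (GLpow n 2).indicator fun h =>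
  ((1 / (2 * Real.pi * Complex.I)) ^ 2 * (1 / 2) : ℂ) •
      trForm (matWedge (mulDiff n 2 1 0 1)
        (mulDiff n 2 1 1 (Ring.inverse (h 1) * Ring.inverse (h 0)))) -
    ((1 / (2 * Real.pi * Complex.I)) ^ 2 * (1 / 2) : ℂ) •
      wedge (ContinuousLinearMap.mul ℝ ℂ) (trForm (mulDiff n 2 (Ring.inverse (h 0)) 0 1))
        (trForm (mulDiff n 2 (Ring.inverse (h 1)) 1 1))

/-- The cochain `c_{1,3} + c_{2,2}` of the total complex. -/
def chernCochain (n : ℕ) : Fam n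
  | 1, 3 => c13 n
  | 2, 2 => c22 n
  | _, _ => 0

end SimplicialDeRham

end

/-! The equality of classes already holds between forms: integrating c_2(Ω) over the simplices gives
c_{1,3} + c_{2,2} exactly (`fiberIntegral_chernSFam`). No coboundary has to be found, and Stokes'
theorem on the simplices is not needed: the cocycle property of I_Δ(c_2(Ω)) follows from that of the
explicit cochain.

Descent. The map γ has the section σ(h) = (1, h₁⁻¹, (h₁h₂)⁻¹, …), and σ∘γ is g ↦ g g_0⁻¹. Under this
map θ_i becomes g_0(θ_i − θ_0)g_0⁻¹. Since ∑ t_i = 1 and ∑ dt_i = 0, subtracting the same θ_0 from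
every θ_i does not change the curvature (`curv_sub`), and c_2 is invariant under conjugation. Hence
c_2(Ω) = (id × σγ)^* c_2(Ω) (`chernForm_gammaSection_gammaMap`), and `chernSFam`, the pullback along
id × σ, is a form on NG with the required pullback under id × γ. As dγ is onto at points of the
section, pullback under id × γ is injective. This gives uniqueness, and it moves compatibility with
faces up to N\bar G, where a vertex of weight 0 just drops out of the curvature (`chernForm_face`).

Integration. On the section θ_0 = 0 and θ_i = −dP_i P_i⁻¹ with P_i = h_1⋯h_i. The curvature has no
dt∧dt part, and its dt_k∧(horizontal) part is θ_k. So the bidegrees (3,1) and (4,0) vanish; (0,4)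
vanishes because θ = 0 there; in (1,3) the horizontal curvature is (t² − t) θ_1∧θ_1, with integral
−1/6 of the coefficient; in (2,2) the integrand is constant in t, and the simplex has area 1/2.

Cocycle conditions. With P = h_1⁻¹dh_1 and Q = dh_2 h_2⁻¹, the Maurer–Cartan form of h_1h_2 is
h_2⁻¹(P + Q)h_2. The three identities then become identities between traces of words in such forms,
settled by cyclicity of the trace. -/

noncomputable section

namespace SimplicialDeRham

open scoped ContDiff

/-! ### Evaluation of forms on vectors -/

section FormLemmas

variable {E E' F F' F'' : Type*}
  [NormedAddCommGroup E] [NormedSpace ℝ E] [NormedAddCommGroup E'] [NormedSpace ℝ E']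
  [NormedAddCommGroup F] [NormedSpace ℝ F] [NormedAddCommGroup F'] [NormedSpace ℝ F']
  [NormedAddCommGroup F''] [NormedSpace ℝ F'']

/-- Evaluation at fixed vectors, as a continuous linear map. -/
def evalCLM {q : ℕ} (v : Fin q → E) : AltForm E F q →L[ℝ] F :=
  ContinuousMultilinearMap.apply ℝ (fun _ : Fin q => E) F v ∘L
    ContinuousAlternatingMap.toContinuousMultilinearMapCLM ℝ

/-- A form on a finite-dimensional space is smooth if its values on fixed vectors are. -/
lemma contDiffOn_of_apply [FiniteDimensional ℝ E] [FiniteDimensional ℝ F] {X : Type*}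
    [NormedAddCommGroup X] [NormedSpace ℝ X] {q : ℕ} {S : Set X} {η : X → AltForm E F q}
    (h : ∀ v, ContDiffOn ℝ ∞ (fun x => η x v) S) : ContDiffOn ℝ ∞ η S := by
  let b := Module.finBasis ℝ E
  let L : AltForm E F q →ₗ[ℝ] ((Fin q → Fin (Module.finrank ℝ E)) → F) :=
    LinearMap.pi fun s => (evalCLM fun i => b (s i)).toLinearMap
  have hL : LinearMap.ker L = ⊥ := by
    refine LinearMap.ker_eq_bot'.2 fun α hα => ?_
    apply ContinuousAlternatingMap.toAlternatingMap_injective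
    refine Module.Basis.ext_alternating b fun s _ => ?_
    -- An alternating form is determined by its values on basis vectors, so L is injective and a
    -- left inverse recovers the form smoothly from finitely many values.
    exact congrFun hα s
  obtain ⟨R, hR⟩ := L.exists_leftInverse_of_injective hL
  have h1 : η = fun x => LinearMap.toContinuousLinearMap R (L (η x)) :=
    funext fun x => (LinearMap.congr_fun hR (η x)).symm
  rw [h1]
  refine (ContinuousLinearMap.contDiff _).comp_contDiffOn (contDiffOn_pi.2 fun s => ?_)
  exact h fun i => b (s i)

/-- Reduces exterior derivatives to one-variable calculus: only the scalar functions obtained by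
moving along the line in direction v_i with the other vectors fixed have to be differentiated. -/
lemma extDeriv_apply_of_hasDerivAt {q : ℕ} {η : E → AltForm E F q} {x : E}
    (hη : DifferentiableAt ℝ η x) (v : Fin (q + 1) → E) {D : Fin (q + 1) → F}
    (hD : ∀ i, HasDerivAt (fun s : ℝ => η (x + s • v i) (i.removeNth v)) (D i) 0) :
    extDeriv η x v = ∑ i : Fin (q + 1), (-1) ^ (i : ℕ) • D i := by
  have key : ∀ i, fderiv ℝ η x (v i) (i.removeNth v) = D i := fun i => by
    have h0 : HasDerivAt (fun s : ℝ => x + s • v i) (v i) 0 := by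
      simpa using ((hasDerivAt_id (0 : ℝ)).smul_const (v i)).const_add x
    have h1 : HasFDerivAt η (fderiv ℝ η x) (x + (0 : ℝ) • v i) := by
      simpa using hη.hasFDerivAt
    have h2 := (evalCLM (F := F) (i.removeNth v)).hasFDerivAt.comp_hasDerivAt (0 : ℝ)
      (h1.comp_hasDerivAt (0 : ℝ) h0)
    exact h2.unique (hD i)
  simp only [extDeriv, ContinuousAlternatingMap.alternatizeUncurryFin_apply, key]

lemma pullback_apply {q : ℕ} (f : E → E') {S : Set E} (η : E' → AltForm E' F q) {x : E}
    (hx : x ∈ S) (v : Fin q → E) :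
    pullback f S η x v = η (f x) fun i => fderiv ℝ f x (v i) := by
  rw [pullback, Set.indicator_of_mem hx]
  rfl

lemma wedge_apply {k l : ℕ} (B : Pairing F F' F'') (α : AltForm E F k) (β : AltForm E F' l)
    (v : Fin (k + l) → E) :
    wedge B α β v = ((k.factorial * l.factorial : ℝ))⁻¹ • ∑ σ : Equiv.Perm (Fin (k + l)),
      Equiv.Perm.sign σ • B (α fun i => v (σ (Fin.castAdd l i))) (β fun j => v (σ (Fin.natAdd k j))) := by
  simp only [wedge, ContinuousAlternatingMap.smul_apply,
    ContinuousMultilinearMap.alternatization_apply_apply]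
  rfl

/-! ### Wedge products in low degrees -/

lemma signed_perms_two :
    (Finset.univ : Finset (Equiv.Perm (Fin 2))).val.map
      (fun σ => (Equiv.Perm.sign σ, (σ : Fin 2 → Fin 2))) =
    ↑[((1 : ℤˣ), ![(0 : Fin 2), 1]), (-1, ![1, 0])] := by decide +kernel

lemma signed_perms_three :
    (Finset.univ : Finset (Equiv.Perm (Fin 3))).val.map
      (fun σ => (Equiv.Perm.sign σ, (σ : Fin 3 → Fin 3))) =
    ↑[((1 : ℤˣ), ![(0 : Fin 3), 1, 2]), (-1, ![0, 2, 1]), (-1, ![1, 0, 2]), (1, ![1, 2, 0]),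
      (1, ![2, 0, 1]), (-1, ![2, 1, 0])] := by decide +kernel

lemma signed_perms_four :
    (Finset.univ : Finset (Equiv.Perm (Fin 4))).val.map
      (fun σ => (Equiv.Perm.sign σ, (σ : Fin 4 → Fin 4))) =
    ↑[((1 : ℤˣ), ![(0 : Fin 4), 1, 2, 3]), (-1, ![0, 1, 3, 2]), (-1, ![0, 2, 1, 3]),
      (1, ![0, 2, 3, 1]), (1, ![0, 3, 1, 2]), (-1, ![0, 3, 2, 1]), (-1, ![1, 0, 2, 3]),
      (1, ![1, 0, 3, 2]), (1, ![1, 2, 0, 3]), (-1, ![1, 2, 3, 0]), (-1, ![1, 3, 0, 2]),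
      (1, ![1, 3, 2, 0]), (1, ![2, 0, 1, 3]), (-1, ![2, 0, 3, 1]), (-1, ![2, 1, 0, 3]),
      (1, ![2, 1, 3, 0]), (1, ![2, 3, 0, 1]), (-1, ![2, 3, 1, 0]), (-1, ![3, 0, 1, 2]),
      (1, ![3, 0, 2, 1]), (1, ![3, 1, 0, 2]), (-1, ![3, 1, 2, 0]), (-1, ![3, 2, 0, 1]),
      (1, ![3, 2, 1, 0])] := by decide +kernel

/-- The summand sees a permutation only through its sign and its underlying function, so the tables
above turn the defining sum of a wedge product into an explicit list. -/
lemma sum_perm_eq {M : Type*} [AddCommMonoid M] {m : ℕ} (l : List (ℤˣ × (Fin m → Fin m)))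
    (hl : (Finset.univ : Finset (Equiv.Perm (Fin m))).val.map
      (fun σ => (Equiv.Perm.sign σ, (σ : Fin m → Fin m))) = ↑l) (g : ℤˣ → (Fin m → Fin m) → M) :
    ∑ σ : Equiv.Perm (Fin m), g (Equiv.Perm.sign σ) σ = (l.map fun x => g x.1 x.2).sum := by
  have h := congrArg
    (fun s => (s.map fun x : ℤˣ × (Fin m → Fin m) => g x.1 x.2).sum) hl
  simp only [Multiset.map_map] at h
  exact h

lemma eq_vec_one {T : Type*} (w : Fin 1 → T) : w = ![w 0] := by
  funext i; fin_cases i; rfl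

lemma wedge_one_one (B : Pairing F F' F'') (α : AltForm E F 1) (β : AltForm E F' 1)
    (v : Fin 2 → E) :
    wedge B α β v = B (α ![v 0]) (β ![v 1]) - B (α ![v 1]) (β ![v 0]) := by
  have h (σ : Equiv.Perm (Fin 2)) : Equiv.Perm.sign σ • B (α fun i => v (σ (Fin.castAdd 1 i)))
      (β fun j => v (σ (Fin.natAdd 1 j))) =
      Equiv.Perm.sign σ • B (α ![v (σ (Fin.castAdd 1 0))]) (β ![v (σ (Fin.natAdd 1 (0 : Fin 1)))]) := by
    rw [eq_vec_one fun i => v (σ (Fin.castAdd 1 i)), eq_vec_one fun i => v (σ (Fin.natAdd 1 i))]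
  rw [wedge_apply, Finset.sum_congr rfl fun σ _ => h σ,
    sum_perm_eq _ signed_perms_two fun s p => s • B (α ![v (p (Fin.castAdd 1 0))])
      (β ![v (p (Fin.natAdd 1 (0 : Fin 1)))])]
  simp [Fin.castAdd, Fin.natAdd, Units.smul_def, sub_eq_add_neg]

lemma map_pair_swap (α : AltForm E F 2) (x y : E) : α ![y, x] = -α ![x, y] := by
  have := α.toAlternatingMap.map_swap ![x, y] (i := 0) (j := 1) (by decide)
  have h : ![x, y] ∘ (Equiv.swap (0 : Fin 2) 1) = ![y, x] := by
    funext i; fin_cases i <;> simp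
  rw [h] at this
  exact this

lemma eq_vec_two {T : Type*} (w : Fin 2 → T) : w = ![w 0, w 1] := by
  funext i; fin_cases i <;> rfl

/-- The six permutations fall into three shuffles, each counted twice, which the normalisation
1/(2!·1!) undoes. -/
lemma wedge_two_one (B : Pairing F F' F'') (α : AltForm E F 2) (β : AltForm E F' 1)
    (v : Fin 3 → E) :
    wedge B α β v = B (α ![v 0, v 1]) (β ![v 2]) - B (α ![v 0, v 2]) (β ![v 1])
      + B (α ![v 1, v 2]) (β ![v 0]) := by
  have h (σ : Equiv.Perm (Fin 3)) : Equiv.Perm.sign σ • B (α fun i => v (σ (Fin.castAdd 1 i)))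
      (β fun j => v (σ (Fin.natAdd 2 j))) =
      Equiv.Perm.sign σ • B (α ![v (σ (Fin.castAdd 1 0)), v (σ (Fin.castAdd 1 1))])
        (β ![v (σ (Fin.natAdd 2 (0 : Fin 1)))]) := by
    rw [eq_vec_two fun i => v (σ (Fin.castAdd 1 i)), eq_vec_one fun i => v (σ (Fin.natAdd 2 i))]
  rw [wedge_apply, Finset.sum_congr rfl fun σ _ => h σ,
    sum_perm_eq _ signed_perms_three fun s p => s • B
      (α ![v (p (Fin.castAdd 1 0)), v (p (Fin.castAdd 1 1))]) (β ![v (p (Fin.natAdd 2 (0 : Fin 1)))])]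
  simp [Fin.castAdd, Fin.natAdd, Units.smul_def, sub_eq_add_neg]
  rw [map_pair_swap α (v 0) (v 1), map_pair_swap α (v 0) (v 2), map_pair_swap α (v 1) (v 2)]
  simp only [map_neg, neg_apply]
  module

/-- By symmetry of B each of the three splittings of four vectors into pairs occurs 8 times among
the 24 permutations; dividing by 2!·2! leaves the factor 2. -/
lemma wedge_two_two (B : Pairing F F F'') (hB : ∀ x y, B x y = B y x) (α : AltForm E F 2)
    (v : Fin 4 → E) :
    wedge B α α v = (2 : ℝ) • (B (α ![v 0, v 1]) (α ![v 2, v 3])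
      - B (α ![v 0, v 2]) (α ![v 1, v 3]) + B (α ![v 0, v 3]) (α ![v 1, v 2])) := by
  have h (σ : Equiv.Perm (Fin 4)) : Equiv.Perm.sign σ • B (α fun i => v (σ (Fin.castAdd 2 i)))
      (α fun j => v (σ (Fin.natAdd 2 j))) =
      Equiv.Perm.sign σ • B (α ![v (σ (Fin.castAdd 2 0)), v (σ (Fin.castAdd 2 1))])
        (α ![v (σ (Fin.natAdd 2 (0 : Fin 2))), v (σ (Fin.natAdd 2 (1 : Fin 2)))]) := by
    rw [eq_vec_two fun i => v (σ (Fin.castAdd 2 i)), eq_vec_two fun i => v (σ (Fin.natAdd 2 i))]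
  rw [wedge_apply, Finset.sum_congr rfl fun σ _ => h σ,
    sum_perm_eq _ signed_perms_four fun s p => s • B
      (α ![v (p (Fin.castAdd 2 0)), v (p (Fin.castAdd 2 1))])
      (α ![v (p (Fin.natAdd 2 (0 : Fin 2))), v (p (Fin.natAdd 2 (1 : Fin 2)))])]
  simp [Fin.castAdd, Fin.natAdd, Units.smul_def, sub_eq_add_neg]
  rw [map_pair_swap α (v 0) (v 1), map_pair_swap α (v 0) (v 2), map_pair_swap α (v 0) (v 3),
    map_pair_swap α (v 1) (v 2), map_pair_swap α (v 1) (v 3), map_pair_swap α (v 2) (v 3)]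
  simp only [map_neg, neg_apply]
  rw [hB (α ![v 2, v 3]), hB (α ![v 1, v 3]), hB (α ![v 1, v 2])]
  module

end FormLemmas

/-! ### Calculus lemmas -/

section Calculus

variable {E F : Type*} [NormedAddCommGroup E] [NormedSpace ℝ E]
  [NormedAddCommGroup F] [NormedSpace ℝ F]

lemma fderiv_apply_of_hasDerivAt {f : E → F} {x v : E} {d : F} (hf : DifferentiableAt ℝ f x)
    (hd : HasDerivAt (fun s : ℝ => f (x + s • v)) d 0) : fderiv ℝ f x v = d := by
  have h0 : HasDerivAt (fun s : ℝ => x + s • v) v 0 := by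
    simpa using ((hasDerivAt_id (0 : ℝ)).smul_const v).const_add x
  have h1 : HasFDerivAt f (fderiv ℝ f x) (x + (0 : ℝ) • v) := by
    simpa using hf.hasFDerivAt
  exact (h1.comp_hasDerivAt (0 : ℝ) h0).unique hd

lemma extDeriv_one_apply {η : E → AltForm E F 1} {x : E} (hη : DifferentiableAt ℝ η x)
    {v : Fin 2 → E} {D₀ D₁ : F}
    (h₀ : HasDerivAt (fun s : ℝ => η (x + s • v 0) ![v 1]) D₀ 0)
    (h₁ : HasDerivAt (fun s : ℝ => η (x + s • v 1) ![v 0]) D₁ 0) :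
    extDeriv η x v = D₀ - D₁ := by
  rw [extDeriv_apply_of_hasDerivAt hη v (D := ![D₀, D₁])]
  · exact (Fin.sum_univ_two _).trans (by simp [sub_eq_add_neg])
  · intro i
    rw [eq_vec_one (i.removeNth v)]
    fin_cases i
    · exact h₀
    · exact h₁

lemma extDeriv_two_apply {η : E → AltForm E F 2} {x : E} (hη : DifferentiableAt ℝ η x)
    {v : Fin 3 → E} {D₀ D₁ D₂ : F}
    (h₀ : HasDerivAt (fun s : ℝ => η (x + s • v 0) ![v 1, v 2]) D₀ 0)
    (h₁ : HasDerivAt (fun s : ℝ => η (x + s • v 1) ![v 0, v 2]) D₁ 0)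
    (h₂ : HasDerivAt (fun s : ℝ => η (x + s • v 2) ![v 0, v 1]) D₂ 0) :
    extDeriv η x v = D₀ - D₁ + D₂ := by
  rw [extDeriv_apply_of_hasDerivAt hη v (D := ![D₀, D₁, D₂])]
  · exact (Fin.sum_univ_three _).trans (by simp [sub_eq_add_neg])
  · intro i
    rw [eq_vec_two (i.removeNth v)]
    fin_cases i
    · exact h₀
    · exact h₁
    · exact h₂

lemma eq_vec_three {T : Type*} (w : Fin 3 → T) : w = ![w 0, w 1, w 2] := by
  funext i; fin_cases i <;> rfl

lemma extDeriv_three_apply {η : E → AltForm E F 3} {x : E} (hη : DifferentiableAt ℝ η x)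
    {v : Fin 4 → E} {D₀ D₁ D₂ D₃ : F}
    (h₀ : HasDerivAt (fun s : ℝ => η (x + s • v 0) ![v 1, v 2, v 3]) D₀ 0)
    (h₁ : HasDerivAt (fun s : ℝ => η (x + s • v 1) ![v 0, v 2, v 3]) D₁ 0)
    (h₂ : HasDerivAt (fun s : ℝ => η (x + s • v 2) ![v 0, v 1, v 3]) D₂ 0)
    (h₃ : HasDerivAt (fun s : ℝ => η (x + s • v 3) ![v 0, v 1, v 2]) D₃ 0) :
    extDeriv η x v = D₀ - D₁ + D₂ - D₃ := by
  rw [extDeriv_apply_of_hasDerivAt hη v (D := ![D₀, D₁, D₂, D₃])]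
  · exact (Fin.sum_univ_four _).trans (by simp [sub_eq_add_neg, pow_succ])
  · intro i
    rw [eq_vec_three (i.removeNth v)]
    fin_cases i
    · exact h₀
    · exact h₁
    · exact h₂
    · exact h₃

lemma fderiv_prodMap_id {T : Type*} [NormedAddCommGroup T] [NormedSpace ℝ T] {f : E → F}
    {x : T × E} (hf : DifferentiableAt ℝ f x.2) (v : T × E) :
    fderiv ℝ (Prod.map (id : T → T) f) x v = (v.1, fderiv ℝ f x.2 v.2) := by
  have h : HasFDerivAt (Prod.map (id : T → T) f)
      ((ContinuousLinearMap.id ℝ T).prodMap (fderiv ℝ f x.2)) x :=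
    (hasFDerivAt_id x.1).prodMap x hf.hasFDerivAt
  rw [h.fderiv]
  rfl

lemma fderiv_prodMap_id_right {T : Type*} [NormedAddCommGroup T] [NormedSpace ℝ T] {f : E → F}
    {x : E × T} (hf : DifferentiableAt ℝ f x.1) (v : E × T) :
    fderiv ℝ (Prod.map f (id : T → T)) x v = (fderiv ℝ f x.1 v.1, v.2) := by
  have h : HasFDerivAt (Prod.map f (id : T → T))
      ((fderiv ℝ f x.1).prodMap (ContinuousLinearMap.id ℝ T)) x :=
    hf.hasFDerivAt.prodMap x (hasFDerivAt_id x.2)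
  rw [h.fderiv]
  rfl

variable {A : Type*} [NormedRing A] [NormedAlgebra ℝ A] [CompleteSpace A]

lemma hasDerivAt_inverse {f : ℝ → A} {d : A} {s : ℝ} (hf : HasDerivAt f d s) (hs : IsUnit (f s)) :
    HasDerivAt (fun r => Ring.inverse (f r))
      (-(Ring.inverse (f s) * d * Ring.inverse (f s))) s := by
  obtain ⟨u, hu⟩ := hs
  have h1 : HasFDerivAt Ring.inverse
      (-ContinuousLinearMap.mulLeftRight ℝ A ↑u⁻¹ ↑u⁻¹) (f s) :=
    hu ▸ hasFDerivAt_ringInverse u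
  have h2 := h1.comp_hasDerivAt s hf
  rw [← hu, Ring.inverse_unit]
  exact h2

lemma contDiffOn_inverse {f : E → A} {S : Set E} (hf : ContDiffOn ℝ ∞ f S)
    (hS : ∀ x ∈ S, IsUnit (f x)) : ContDiffOn ℝ ∞ (fun x => Ring.inverse (f x)) S := by
  intro x hx
  obtain ⟨u, hu⟩ := hS x hx
  have h1 : ContDiffAt ℝ ∞ (Ring.inverse : A → A) (f x) := hu ▸ contDiffAt_ringInverse ℝ u
  exact h1.comp_contDiffWithinAt x (hf x hx)

end Calculus

/-! ### The algebraic expression for the curvature -/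

section Algebra

variable {A : Type*} [Ring A] [Algebra ℝ A] {m : ℕ}

/-- The curvature of `∑ t_i θ_i` on a pair of vectors, where `dθ_i = -θ_i ∧ θ_i` and `a`, `b` are
the values of the `dt_i` and `X`, `Y` the values of the `θ_i` on the two vectors. -/
def curv (t a b : Fin m → ℝ) (X Y : Fin m → A) : A :=
  ∑ i, a i • Y i - ∑ i, b i • X i - ∑ i, t i • (X i * Y i - Y i * X i) +
    ((∑ i, t i • X i) * (∑ i, t i • Y i) - (∑ i, t i • Y i) * ∑ i, t i • X i)

/-- The linear terms change by multiples of ∑ a_i and ∑ b_i. In the quadratic terms, the corrections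
to ∑ t_i [X_i, Y_i] and to [∑ t_i X_i, ∑ t_i Y_i] coincide because the weights sum to 1. This is the
algebra behind c_2(Ω) being basic. -/
lemma curv_sub {t a b : Fin m → ℝ} (ht : ∑ i, t i = 1) (ha : ∑ i, a i = 0) (hb : ∑ i, b i = 0)
    (X Y : Fin m → A) (c d : A) :
    curv t a b (fun i => X i - c) (fun i => Y i - d) = curv t a b X Y := by
  simp only [curv, mul_sub, sub_mul, smul_sub, Finset.sum_sub_distrib, ← Finset.sum_smul, ht, ha,
    hb, ← smul_mul_assoc, ← Finset.sum_mul, one_smul, zero_smul]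
  simp only [← mul_smul_comm, ← Finset.mul_sum, smul_mul_assoc]
  simp only [mul_smul_comm]
  abel

lemma curv_conj (t a b : Fin m → ℝ) (X Y : Fin m → A) {u u' : A} (h : u' * u = 1) :
    curv t a b (fun i => u * X i * u') (fun i => u * Y i * u') = u * curv t a b X Y * u' := by
  have h1 (x y : A) : u * x * u' * (u * y * u') = u * (x * y) * u' := by
    calc u * x * u' * (u * y * u') = u * x * (u' * u) * (y * u') := by noncomm_ring
    _ = _ := by rw [h]; noncomm_ring
  have h2 (r : Fin m → ℝ) (Z : Fin m → A) :
      ∑ i, r i • (u * Z i * u') = u * (∑ i, r i • Z i) * u' := by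
    simp [Finset.mul_sum, Finset.sum_mul]
  simp only [curv, h1, h2, smul_sub, Finset.sum_sub_distrib]
  noncomm_ring

/-- A vertex with zero weight and zero differential contributes to no term; this is the
compatibility with faces in algebraic form. -/
lemma curv_insertNth (t a b : Fin m → ℝ) (X Y : Fin (m + 1) → A) (i : Fin (m + 1)) :
    curv (i.insertNth (α := fun _ => ℝ) 0 t) (i.insertNth (α := fun _ => ℝ) 0 a)
      (i.insertNth (α := fun _ => ℝ) 0 b) X Y =
      curv t a b (fun j => X (i.succAbove j)) fun j => Y (i.succAbove j) := by
  simp [curv, Fin.sum_univ_succAbove _ i]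

end Algebra

/-! ### The curvature of the canonical connection -/

/-- The differential of the barycentric coordinates. -/
def dbary {p : ℕ} (τ : Fin p → ℝ) : Fin (p + 1) → ℝ := Fin.cons (-∑ i, τ i) τ

lemma sum_bary {p : ℕ} (t : Fin p → ℝ) : ∑ i, bary t i = 1 := by
  simp [bary, Fin.sum_univ_succ]

lemma sum_dbary {p : ℕ} (t : Fin p → ℝ) : ∑ i, dbary t i = 0 := by
  simp [dbary, Fin.sum_univ_succ]

lemma bary_add_smul {p : ℕ} (t τ : Fin p → ℝ) (s : ℝ) (i : Fin (p + 1)) :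
    bary (t + s • τ) i = bary t i + s * dbary τ i := by
  refine Fin.cases ?_ (fun j => ?_) i
  · simp [bary, dbary, Finset.sum_add_distrib, Finset.mul_sum]; ring
  · simp [bary, dbary]

lemma hasDerivAt_bary {p : ℕ} (t τ : Fin p → ℝ) (i : Fin (p + 1)) :
    HasDerivAt (fun s : ℝ => bary (t + s • τ) i) (dbary τ i) 0 := by
  simp only [bary_add_smul]
  simpa using ((hasDerivAt_id (0 : ℝ)).mul_const (dbary τ i)).const_add (bary t i)

lemma contDiff_bary {p : ℕ} (i : Fin (p + 1)) :
    ContDiff ℝ ∞ fun t : Fin p → ℝ => bary t i := by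
  refine Fin.cases ?_ (fun j => ?_) i
  · simp only [bary, Fin.cons_zero]; fun_prop
  · simp only [bary, Fin.cons_succ]; fun_prop

lemma bary_eq_of_sum {p : ℕ} {z : Fin (p + 1) → ℝ} (hz : ∑ i, z i = 1) : bary (Fin.tail z) = z := by
  rw [Fin.sum_univ_succ] at hz
  have : 1 - ∑ i : Fin p, Fin.tail z i = z 0 := by simp only [Fin.tail]; linarith
  rw [bary, this, Fin.cons_self_tail]

lemma dbary_eq_of_sum {p : ℕ} {z : Fin (p + 1) → ℝ} (hz : ∑ i, z i = 0) :
    dbary (Fin.tail z) = z := by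
  rw [Fin.sum_univ_succ] at hz
  have : -∑ i : Fin p, Fin.tail z i = z 0 := by simp only [Fin.tail]; linarith
  rw [dbary, this, Fin.cons_self_tail]

lemma connection_apply {n p : ℕ} (x : (Fin p → ℝ) × Amb n (p + 1))
    (v : Fin 1 → (Fin p → ℝ) × Amb n (p + 1)) : connection n p x v =
      ∑ i, bary x.1 i • (Ring.inverse (x.2 i) * (v 0).2 i) := by
  simp [connection, oneForm, ContinuousAlternatingMap.sum_apply]

lemma contDiffOn_connection (n p : ℕ) :
    ContDiffOn ℝ ∞ (connection n p) (Set.univ ×ˢ GLpow n (p + 1)) := by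
  refine contDiffOn_of_apply fun v => ?_
  simp only [connection_apply]
  refine ContDiffOn.sum fun i _ => ContDiffOn.smul
    ((contDiff_bary i).comp contDiff_fst).contDiffOn (ContDiffOn.mul ?_ contDiffOn_const)
  refine contDiffOn_inverse ?_ fun x hx => hx.2 i
  exact ((contDiff_apply ℝ (Mat n) i).comp contDiff_snd).contDiffOn

lemma isOpen_univ_prod_GLpow (n p : ℕ) :
    IsOpen ((Set.univ : Set (Fin p → ℝ)) ×ˢ GLpow n (p + 1)) :=
  isOpen_univ.prod (isOpen_GLpow n (p + 1))

/-- Differentiating g_i⁻¹ gives −g_i⁻¹ dg_i g_i⁻¹, hence dθ_i = −θ_i∧θ_i. The commutator wedge of θ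
with itself is twice [θ(v_0), θ(v_1)], which cancels the factor ½. -/
lemma curvature_apply {n p : ℕ} {x : (Fin p → ℝ) × Amb n (p + 1)} (hx : x.2 ∈ GLpow n (p + 1))
    (v : Fin 2 → (Fin p → ℝ) × Amb n (p + 1)) :
    curvature n p x v = curv (bary x.1) (dbary (v 0).1) (dbary (v 1).1)
      (fun i => Ring.inverse (x.2 i) * (v 0).2 i) fun i => Ring.inverse (x.2 i) * (v 1).2 i := by
  have hd : DifferentiableAt ℝ (connection n p) x :=
    ((contDiffOn_connection n p).contDiffAt
      ((isOpen_univ_prod_GLpow n p).mem_nhds ⟨Set.mem_univ _, hx⟩)).differentiableAt (by simp)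
  have hD (u w : (Fin p → ℝ) × Amb n (p + 1)) :
      HasDerivAt (fun s : ℝ => connection n p (x + s • u) ![w])
        (∑ i, (bary x.1 i • (-(Ring.inverse (x.2 i) * u.2 i * Ring.inverse (x.2 i)) * w.2 i) +
          dbary u.1 i • (Ring.inverse (x.2 i) * w.2 i))) 0 := by
    simp only [connection_apply, Matrix.cons_val_zero]
    refine HasDerivAt.fun_sum fun i _ => ?_
    have h1 : HasDerivAt (fun s : ℝ => x.2 i + s • u.2 i) (u.2 i) 0 := by
      simpa using ((hasDerivAt_id (0 : ℝ)).smul_const (u.2 i)).const_add (x.2 i)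
    have h2 := (hasDerivAt_inverse h1 (by simpa using hx i)).mul_const (w.2 i)
    have h3 := (hasDerivAt_bary x.1 u.1 i).smul h2
    convert h3 using 1
    · rfl
    · simp
  rw [curvature, ContinuousAlternatingMap.add_apply, ContinuousAlternatingMap.smul_apply,
    extDeriv_one_apply hd (hD (v 0) (v 1)) (hD (v 1) (v 0)), wedge_one_one]
  simp only [bracket, connection_apply, sub_apply, ContinuousLinearMap.mul_apply',
    ContinuousLinearMap.flip_apply, Matrix.cons_val_zero, curv, Finset.sum_add_distrib, smul_sub,
    Finset.sum_sub_distrib, neg_mul, smul_neg, Finset.sum_neg_distrib, mul_assoc]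
  module

/-! ### The map `γ` and a section of it -/

section Inverse

variable {A : Type*} [Ring A]

lemma inverse_mul_eq {x y : A} (hx : IsUnit x) (hy : IsUnit y) :
    Ring.inverse (x * y) = Ring.inverse y * Ring.inverse x := by
  obtain ⟨u, rfl⟩ := hx
  obtain ⟨w, rfl⟩ := hy
  rw [← Units.val_mul, Ring.inverse_unit, Ring.inverse_unit, Ring.inverse_unit, mul_inv_rev,
    Units.val_mul]

lemma inverse_inverse_eq {x : A} (hx : IsUnit x) : Ring.inverse (Ring.inverse x) = x := by
  obtain ⟨u, rfl⟩ := hx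
  rw [Ring.inverse_unit, Ring.inverse_unit, inv_inv]

lemma isUnit_inverse {x : A} (hx : IsUnit x) : IsUnit (Ring.inverse x) := hx.ringInverse

end Inverse

/-- The chain rule in a form that needs only a formula for the composite near x; in this way no
explicit derivative of `gammaMap` or `gammaSection` is needed for the identities between them. -/
lemma fderiv_fderiv_apply {E F G : Type*} [NormedAddCommGroup E] [NormedSpace ℝ E]
    [NormedAddCommGroup F] [NormedSpace ℝ F] [NormedAddCommGroup G] [NormedSpace ℝ G]
    {f : E → F} {g : F → G} {r : E → G} {S : Set E} (hS : IsOpen S) {x : E} (hx : x ∈ S)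
    (hg : DifferentiableAt ℝ g (f x)) (hf : DifferentiableAt ℝ f x)
    (h : ∀ y ∈ S, g (f y) = r y) (v : E) :
    fderiv ℝ g (f x) (fderiv ℝ f x v) = fderiv ℝ r x v := by
  have h1 : g ∘ f =ᶠ[nhds x] r := by
    filter_upwards [hS.mem_nhds hx] with y hy using h y hy
  rw [← h1.fderiv_eq, fderiv_comp x hg hf]
  rfl

lemma contDiffOn_gammaMap (n p : ℕ) : ContDiffOn ℝ ∞ (gammaMap n p) (GLpow n (p + 1)) := by
  refine contDiffOn_pi.2 fun i => ?_
  exact (contDiff_apply ℝ (Mat n) _).contDiffOn.mul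
    (contDiffOn_inverse (contDiff_apply ℝ (Mat n) _).contDiffOn fun g hg => hg _)

lemma mapsTo_gammaMap (n p : ℕ) : Set.MapsTo (gammaMap n p) (GLpow n (p + 1)) (GLpow n p) :=
  fun _ hg _ => (hg _).mul (isUnit_inverse (hg _))

/-- A section of `γ`: the point of `N\bar G(p)` with the entries `1, h₁⁻¹, (h₁h₂)⁻¹, …`. -/
def gammaSection (n p : ℕ) (h : Amb n p) : Amb n (p + 1) := fun i =>
  Ring.inverse (Fin.partialProd h i)

lemma isUnit_partialProd {n p : ℕ} {h : Amb n p} (hh : h ∈ GLpow n p) (i : Fin (p + 1)) :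
    IsUnit (Fin.partialProd h i) := by
  induction i using Fin.induction with
  | zero => simp
  | succ i ih => rw [Fin.partialProd_succ]; exact ih.mul (hh i)

lemma contDiff_partialProd {n p : ℕ} (i : Fin (p + 1)) :
    ContDiff ℝ ∞ fun h : Amb n p => Fin.partialProd h i := by
  induction i using Fin.induction with
  | zero => simpa using contDiff_const
  | succ i ih => simpa only [Fin.partialProd_succ] using ih.mul (contDiff_apply ℝ (Mat n) i)

lemma contDiffOn_gammaSection (n p : ℕ) : ContDiffOn ℝ ∞ (gammaSection n p) (GLpow n p) :=
  contDiffOn_pi.2 fun i => contDiffOn_inverse (contDiff_partialProd i).contDiffOn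
    fun _ hh => isUnit_partialProd hh i

lemma mapsTo_gammaSection (n p : ℕ) :
    Set.MapsTo (gammaSection n p) (GLpow n p) (GLpow n (p + 1)) :=
  fun _ hh i => isUnit_inverse (isUnit_partialProd hh i)

lemma gammaMap_gammaSection {n p : ℕ} {h : Amb n p} (hh : h ∈ GLpow n p) :
    gammaMap n p (gammaSection n p h) = h := by
  funext i
  have h1 := isUnit_partialProd hh i.castSucc
  rw [gammaMap, gammaSection, gammaSection, inverse_inverse_eq (isUnit_partialProd hh i.succ),
    Fin.partialProd_succ, ← mul_assoc, Ring.inverse_mul_cancel _ h1, one_mul]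

/-- The partial products of the g_{i-1} g_i⁻¹ telescope to g_0 g_i⁻¹, whose inverses are g_i g_0⁻¹.
-/
lemma gammaSection_gammaMap {n p : ℕ} {g : Amb n (p + 1)} (hg : g ∈ GLpow n (p + 1)) :
    gammaSection n p (gammaMap n p g) = fun i => g i * Ring.inverse (g 0) := by
  have h (i : Fin (p + 1)) : Fin.partialProd (gammaMap n p g) i = g 0 * Ring.inverse (g i) := by
    induction i using Fin.induction with
    | zero => rw [Fin.partialProd_zero, Ring.mul_inverse_cancel _ (hg 0)]
    | succ i ih =>
      rw [Fin.partialProd_succ, ih, gammaMap, mul_assoc, ← mul_assoc (Ring.inverse _),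
        Ring.inverse_mul_cancel _ (hg _), one_mul]
  funext i
  rw [gammaSection, h, inverse_mul_eq (hg 0) (isUnit_inverse (hg i)), inverse_inverse_eq (hg i)]

lemma differentiableAt_of_contDiffOn_GLpow {n p : ℕ} {F : Type*} [NormedAddCommGroup F]
    [NormedSpace ℝ F] {f : Amb n p → F} (hf : ContDiffOn ℝ ∞ f (GLpow n p)) {h : Amb n p}
    (hh : h ∈ GLpow n p) : DifferentiableAt ℝ f h :=
  (hf.contDiffAt ((isOpen_GLpow n p).mem_nhds hh)).differentiableAt (by simp)

/-- Gives surjectivity of dγ along the section, the source of injectivity of pullback under id × γ.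
-/
lemma fderiv_gammaMap_gammaSection {n p : ℕ} {h : Amb n p} (hh : h ∈ GLpow n p) (v : Amb n p) :
    fderiv ℝ (gammaMap n p) (gammaSection n p h) (fderiv ℝ (gammaSection n p) h v) = v := by
  rw [fderiv_fderiv_apply (r := id) (isOpen_GLpow n p) hh
    (differentiableAt_of_contDiffOn_GLpow (contDiffOn_gammaMap n p) (mapsTo_gammaSection n p hh))
    (differentiableAt_of_contDiffOn_GLpow (contDiffOn_gammaSection n p) hh)
    fun y hy => gammaMap_gammaSection hy, fderiv_id]
  rfl

lemma fderiv_gammaSection_gammaMap {n p : ℕ} {g : Amb n (p + 1)} (hg : g ∈ GLpow n (p + 1))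
    (v : Amb n (p + 1)) (i : Fin (p + 1)) :
    fderiv ℝ (gammaSection n p) (gammaMap n p g) (fderiv ℝ (gammaMap n p) g v) i =
      v i * Ring.inverse (g 0) - g i * (Ring.inverse (g 0) * v 0 * Ring.inverse (g 0)) := by
  have hr : DifferentiableAt ℝ (fun g : Amb n (p + 1) => fun i => g i * Ring.inverse (g 0)) g := by
    refine differentiableAt_of_contDiffOn_GLpow (contDiffOn_pi.2 fun i => ?_) hg
    exact (contDiff_apply ℝ (Mat n) _).contDiffOn.mul
      (contDiffOn_inverse (contDiff_apply ℝ (Mat n) _).contDiffOn fun g hg => hg _)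
  rw [fderiv_fderiv_apply (isOpen_GLpow n (p + 1)) hg
    (differentiableAt_of_contDiffOn_GLpow (contDiffOn_gammaSection n p) (mapsTo_gammaMap n p hg))
    (differentiableAt_of_contDiffOn_GLpow (contDiffOn_gammaMap n p) hg)
    fun y hy => gammaSection_gammaMap hy]
  have h1 (k : Fin (p + 1)) : HasDerivAt (fun s : ℝ => (g + s • v) k) (v k) 0 := by
    simpa using ((hasDerivAt_id (0 : ℝ)).smul_const (v k)).const_add (g k)
  have h2 := hasDerivAt_inverse (h1 0) (by simpa using hg 0)
  rw [fderiv_apply_of_hasDerivAt hr (hasDerivAt_pi.2 fun k => (h1 k).mul h2)]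
  simp [sub_eq_add_neg]

/-! ### Invariance of the Chern form -/

lemma tr_mul_comm {n : ℕ} (X Y : Mat n) : tr n (X * Y) = tr n (Y * X) := by
  rw [tr_apply, tr_apply, toMatrix_mul, toMatrix_mul, Matrix.trace_mul_comm]

lemma chern2_symm {n : ℕ} (X Y : Mat n) : chern2 n X Y = chern2 n Y X := by
  rw [chern2_apply, chern2_apply, tr_mul_comm X Y, mul_comm (tr n X)]

lemma chern2_conj {n : ℕ} (X Y : Mat n) {u u' : Mat n} (h : u' * u = 1) :
    chern2 n (u * X * u') (u * Y * u') = chern2 n X Y := by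
  have h1 (Z : Mat n) : tr n (u * Z * u') = tr n Z := by
    rw [tr_mul_comm, ← mul_assoc, h, one_mul]
  have h2 : u * X * u' * (u * Y * u') = u * (X * Y) * u' := by
    calc u * X * u' * (u * Y * u') = u * X * (u' * u) * (Y * u') := by noncomm_ring
    _ = _ := by rw [h]; noncomm_ring
  rw [chern2_apply, chern2_apply, h2, h1, h1, h1]

/-- The form `c_2(Ω)` on `Δ^p × N\bar G(p)`. -/
def chernForm (n p : ℕ) (x : (Fin p → ℝ) × Amb n (p + 1)) :
    AltForm ((Fin p → ℝ) × Amb n (p + 1)) ℂ 4 :=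
  wedge (chern2 n) (curvature n p x) (curvature n p x)

lemma chernForm_apply {n p : ℕ} (x : (Fin p → ℝ) × Amb n (p + 1))
    (v : Fin 4 → (Fin p → ℝ) × Amb n (p + 1)) : chernForm n p x v =
      (2 : ℝ) • (chern2 n (curvature n p x ![v 0, v 1]) (curvature n p x ![v 2, v 3])
      - chern2 n (curvature n p x ![v 0, v 2]) (curvature n p x ![v 1, v 3])
      + chern2 n (curvature n p x ![v 0, v 3]) (curvature n p x ![v 1, v 2])) :=
  wedge_two_two _ chern2_symm _ _

lemma contDiffOn_curvature (n p : ℕ) :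
    ContDiffOn ℝ ∞ (curvature n p) (Set.univ ×ˢ GLpow n (p + 1)) := by
  refine contDiffOn_of_apply fun v => ?_
  refine ContDiffOn.congr ?_ fun x hx => curvature_apply hx.2 v
  have h1 (w : Amb n (p + 1)) (i : Fin (p + 1)) : ContDiffOn ℝ ∞
      (fun x : (Fin p → ℝ) × Amb n (p + 1) => Ring.inverse (x.2 i) * w i)
      (Set.univ ×ˢ GLpow n (p + 1)) := by
    refine ContDiffOn.mul (contDiffOn_inverse ?_ fun x hx => hx.2 i) contDiffOn_const
    exact ((contDiff_apply ℝ (Mat n) i).comp contDiff_snd).contDiffOn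
  have h2 (i : Fin (p + 1)) : ContDiffOn ℝ ∞
      (fun x : (Fin p → ℝ) × Amb n (p + 1) => bary x.1 i) (Set.univ ×ˢ GLpow n (p + 1)) :=
    ((contDiff_bary i).comp contDiff_fst).contDiffOn
  have h3 (w : Amb n (p + 1)) : ContDiffOn ℝ ∞ (fun x : (Fin p → ℝ) × Amb n (p + 1) =>
      ∑ i, bary x.1 i • (Ring.inverse (x.2 i) * w i)) (Set.univ ×ˢ GLpow n (p + 1)) :=
    ContDiffOn.sum fun i _ => (h2 i).smul (h1 w i)
  have h4 (a : Fin (p + 1) → ℝ) (w : Amb n (p + 1)) :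
      ContDiffOn ℝ ∞ (fun x : (Fin p → ℝ) × Amb n (p + 1) =>
      ∑ i, a i • (Ring.inverse (x.2 i) * w i)) (Set.univ ×ˢ GLpow n (p + 1)) :=
    ContDiffOn.sum fun i _ => (h1 w i).const_smul (a i)
  refine ContDiffOn.add (ContDiffOn.sub (ContDiffOn.sub (h4 _ _) (h4 _ _)) ?_)
    (((h3 _).mul (h3 _)).sub ((h3 _).mul (h3 _)))
  exact ContDiffOn.sum fun i _ => (h2 i).smul (((h1 _ i).mul (h1 _ i)).sub ((h1 _ i).mul (h1 _ i)))

lemma contDiffOn_chernForm (n p : ℕ) :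
    ContDiffOn ℝ ∞ (chernForm n p) (Set.univ ×ˢ GLpow n (p + 1)) := by
  refine contDiffOn_of_apply fun v => ?_
  simp only [chernForm_apply]
  have h (v w : (Fin p → ℝ) × Amb n (p + 1)) : ContDiffOn ℝ ∞
      (fun x => curvature n p x ![v, w]) (Set.univ ×ˢ GLpow n (p + 1)) :=
    (evalCLM (F := Mat n) ![v, w]).contDiff.comp_contDiffOn (contDiffOn_curvature n p)
  have h2 (v w v' w' : (Fin p → ℝ) × Amb n (p + 1)) : ContDiffOn ℝ ∞
      (fun x => chern2 n (curvature n p x ![v, w]) (curvature n p x ![v', w']))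
      (Set.univ ×ˢ GLpow n (p + 1)) :=
    ((chern2 n).contDiff.comp_contDiffOn (h v w)).clm_apply (h v' w')
  exact (((h2 _ _ _ _).sub (h2 _ _ _ _)).add (h2 _ _ _ _)).const_smul (2 : ℝ)

/-- The form is a polynomial in the curvature values that does not see a common conjugation, so a
comparison of Chern forms reduces to one of curvatures on pairs of vectors. -/
lemma chernForm_eq {n p p' : ℕ} {x : (Fin p → ℝ) × Amb n (p + 1)}
    {x' : (Fin p' → ℝ) × Amb n (p' + 1)} {v : Fin 4 → (Fin p → ℝ) × Amb n (p + 1)}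
    {v' : Fin 4 → (Fin p' → ℝ) × Amb n (p' + 1)} {u u' : Mat n} (hu : u' * u = 1)
    (h : ∀ i j, curvature n p' x' ![v' i, v' j] = u * curvature n p x ![v i, v j] * u') :
    chernForm n p' x' v' = chernForm n p x v := by
  simp only [chernForm_apply, h, chern2_conj _ _ hu]

/-- `c_2(Ω)` is basic: it is invariant under the translation `g ↦ g g_0⁻¹`. -/
lemma chernForm_gammaSection_gammaMap {n p : ℕ} {x : (Fin p → ℝ) × Amb n (p + 1)}
    (hx : x.2 ∈ GLpow n (p + 1)) (v : Fin 4 → (Fin p → ℝ) × Amb n (p + 1)) :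
    chernForm n p (x.1, gammaSection n p (gammaMap n p x.2)) (fun k => ((v k).1,
      fderiv ℝ (gammaSection n p) (gammaMap n p x.2) (fderiv ℝ (gammaMap n p) x.2 (v k).2))) =
      chernForm n p x v := by
  refine chernForm_eq (u := x.2 0) (u' := Ring.inverse (x.2 0))
    (Ring.inverse_mul_cancel _ (hx 0)) fun k l => ?_
  have hm := mapsTo_gammaSection n p (mapsTo_gammaMap n p hx)
  rw [curvature_apply hm, curvature_apply hx]
  -- The gauge change: under g ↦ g g_0⁻¹ the form θ_i becomes g_0(θ_i − θ_0)g_0⁻¹.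
  have h1 (w : Amb n (p + 1)) (i : Fin (p + 1)) :
      Ring.inverse (gammaSection n p (gammaMap n p x.2) i) *
      fderiv ℝ (gammaSection n p) (gammaMap n p x.2) (fderiv ℝ (gammaMap n p) x.2 w) i =
      x.2 0 * (Ring.inverse (x.2 i) * w i - Ring.inverse (x.2 0) * w 0) * Ring.inverse (x.2 0) := by
    rw [fderiv_gammaSection_gammaMap hx, gammaSection_gammaMap hx,
      inverse_mul_eq (hx i) (isUnit_inverse (hx 0)), inverse_inverse_eq (hx 0), mul_sub, mul_sub,
      sub_mul]
    congr 1
    · noncomm_ring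
    · calc x.2 0 * Ring.inverse (x.2 i) *
          (x.2 i * (Ring.inverse (x.2 0) * w 0 * Ring.inverse (x.2 0))) =
          x.2 0 * (Ring.inverse (x.2 i) * x.2 i) *
            (Ring.inverse (x.2 0) * w 0 * Ring.inverse (x.2 0)) := by noncomm_ring
      _ = _ := by rw [Ring.inverse_mul_cancel _ (hx i)]; noncomm_ring
  simp only [Matrix.cons_val_zero, Matrix.cons_val_one, h1]
  rw [curv_conj _ _ _ _ _ (Ring.inverse_mul_cancel _ (hx 0)),
    curv_sub (sum_bary _) (sum_dbary _) (sum_dbary _)]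

/-! ### The simplicial form `c_2(Ω)` on `NG` -/

/-- Pullback along `id × γ` is injective. -/
lemma eq_of_pullback_gammaMap {n p k : ℕ} {T : Type*} [NormedAddCommGroup T] [NormedSpace ℝ T]
    {D : Set T} {α β : T × Amb n p → AltForm (T × Amb n p) ℂ k}
    (h : ∀ x ∈ D ×ˢ GLpow n (p + 1), ∀ v : Fin k → T × Amb n (p + 1), α (x.1, gammaMap n p x.2)
        (fun i => ((v i).1, fderiv ℝ (gammaMap n p) x.2 (v i).2)) = β (x.1, gammaMap n p x.2)
        (fun i => ((v i).1, fderiv ℝ (gammaMap n p) x.2 (v i).2))) :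
    ∀ x ∈ D ×ˢ GLpow n p, α x = β x := by
  intro x hx
  ext v
  -- Test the hypothesis on the lift of x and v through the section; γ and dγ bring them back to x
  -- and v.
  have h1 := h (x.1, gammaSection n p x.2) ⟨hx.1, mapsTo_gammaSection n p hx.2⟩
    fun i => ((v i).1, fderiv ℝ (gammaSection n p) x.2 (v i).2)
  simpa only [gammaMap_gammaSection hx.2, fderiv_gammaMap_gammaSection hx.2, Prod.mk.eta] using h1

lemma pullback_gammaMap_apply {n p k : ℕ} {D : Set (Fin p → ℝ)}
    (α : (Fin p → ℝ) × Amb n p → AltForm ((Fin p → ℝ) × Amb n p) ℂ k)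
    {x : (Fin p → ℝ) × Amb n (p + 1)} (hx : x ∈ D ×ˢ GLpow n (p + 1))
    (v : Fin k → (Fin p → ℝ) × Amb n (p + 1)) :
    pullback (Prod.map id (gammaMap n p)) (D ×ˢ GLpow n (p + 1)) α x v =
      α (x.1, gammaMap n p x.2) (fun i => ((v i).1, fderiv ℝ (gammaMap n p) x.2 (v i).2)) := by
  rw [pullback_apply _ _ hx]
  simp only [fderiv_prodMap_id
    (differentiableAt_of_contDiffOn_GLpow (contDiffOn_gammaMap n p) hx.2)]
  rfl

/-- The form on `Δ^p × NG(p)` whose pullback under `id × γ` is `c_2(Ω)`. -/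
def chernSFam (n : ℕ) : SFam n 4 := fun p =>
  pullback (Prod.map id (gammaSection n p)) (simplex p ×ˢ GLpow n p) (chernForm n p)

lemma chernSFam_apply {n p : ℕ} {x : (Fin p → ℝ) × Amb n p} (hx : x ∈ simplex p ×ˢ GLpow n p)
    (v : Fin 4 → (Fin p → ℝ) × Amb n p) : chernSFam n p x v =
      chernForm n p (x.1, gammaSection n p x.2)
        (fun i => ((v i).1, fderiv ℝ (gammaSection n p) x.2 (v i).2)) := by
  rw [chernSFam, pullback_apply _ _ hx]
  simp only [fderiv_prodMap_id
    (differentiableAt_of_contDiffOn_GLpow (contDiffOn_gammaSection n p) hx.2)]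
  rfl

lemma chernSFam_gammaMap {n p : ℕ} {x : (Fin p → ℝ) × Amb n (p + 1)}
    (hx : x ∈ simplex p ×ˢ GLpow n (p + 1)) (v : Fin 4 → (Fin p → ℝ) × Amb n (p + 1)) :
    chernSFam n p (x.1, gammaMap n p x.2)
      (fun i => ((v i).1, fderiv ℝ (gammaMap n p) x.2 (v i).2)) = chernForm n p x v := by
  have h := chernSFam_apply (x := (x.1, gammaMap n p x.2)) ⟨hx.1, mapsTo_gammaMap n p hx.2⟩
    fun i => ((v i).1, fderiv ℝ (gammaMap n p) x.2 (v i).2)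
  have h' := chernForm_gammaSection_gammaMap hx.2 v
  dsimp only at h
  rw [h, h']

lemma chernSFam_mem (n p : ℕ) : chernSFam n p ∈ Forms (simplex p ×ˢ GLpow n p) 4 := by
  refine ⟨?_, fun x hx => by rw [chernSFam, pullback, Set.indicator_of_notMem hx]⟩
  have hO : IsOpen ((Set.univ : Set (Fin p → ℝ)) ×ˢ GLpow n p) :=
    isOpen_univ.prod (isOpen_GLpow n p)
  have hs : ContDiffOn ℝ ∞ (Prod.map id (gammaSection n p) : (Fin p → ℝ) × Amb n p → _)
      (Set.univ ×ˢ GLpow n p) :=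
    contDiffOn_id.prodMap (contDiffOn_gammaSection n p)
  -- Since the simplex is not open, smoothness is first shown with all of ℝ^p in its place, where
  -- `fderiv` is under control, and then restricted.
  have h1 : ContDiffOn ℝ ∞ (pullback (Prod.map id (gammaSection n p)) (Set.univ ×ˢ GLpow n p)
      (chernForm n p)) (Set.univ ×ˢ GLpow n p) := by
    refine ContDiffOn.congr ?_ fun x hx => Set.indicator_of_mem hx _
    refine (contDiff_compCLM 4).comp_contDiffOn (((contDiffOn_chernForm n p).comp hs ?_).prodMk
      (hs.fderiv_of_isOpen hO (m := ∞) (by simp)))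
    exact fun x hx => ⟨hx.1, mapsTo_gammaSection n p hx.2⟩
  refine (h1.mono (Set.prod_mono_left (Set.subset_univ _))).congr fun x hx => ?_
  rw [chernSFam, pullback, pullback, Set.indicator_of_mem hx,
    Set.indicator_of_mem (show x ∈ Set.univ ×ˢ GLpow n p from ⟨trivial, hx.2⟩)]

/-! ### Compatibility with the face maps -/

lemma bary_simplexFace {p : ℕ} (i : Fin (p + 2)) (t : Fin p → ℝ) :
    bary (simplexFace i t) = i.insertNth (α := fun _ => ℝ) 0 (bary t) := by
  refine bary_eq_of_sum ?_
  simp [Fin.sum_univ_succAbove _ i, sum_bary]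

lemma mem_simplex_iff {p : ℕ} {t : Fin p → ℝ} : t ∈ simplex p ↔ ∀ i, 0 ≤ bary t i := by
  rw [Fin.forall_fin_succ]
  simp [simplex, bary, and_comm]

lemma simplexFace_mem {p : ℕ} (i : Fin (p + 2)) {t : Fin p → ℝ} (ht : t ∈ simplex p) :
    simplexFace i t ∈ simplex (p + 1) := by
  rw [mem_simplex_iff] at ht ⊢
  rw [bary_simplexFace]
  intro j
  rcases Fin.eq_self_or_eq_succAbove i j with h | ⟨k, h⟩
  · rw [h, Fin.insertNth_apply_same]
  · rw [h, Fin.insertNth_apply_succAbove]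
    exact ht k

lemma differentiable_simplexFace {p : ℕ} (i : Fin (p + 2)) :
    Differentiable ℝ (simplexFace (p := p) i) := by
  refine differentiable_pi.2 fun j => ?_
  simp only [simplexFace, Fin.tail]
  rcases Fin.eq_self_or_eq_succAbove i j.succ with h | ⟨k, h⟩
  · simp only [h, Fin.insertNth_apply_same]; fun_prop
  · simp only [h, Fin.insertNth_apply_succAbove]
    exact (contDiff_bary k).differentiable (by simp)

lemma dbary_fderiv_simplexFace {p : ℕ} (i : Fin (p + 2)) (t τ : Fin p → ℝ) :
    dbary (fderiv ℝ (simplexFace i) t τ) = i.insertNth (α := fun _ => ℝ) 0 (dbary τ) := by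
  have h : fderiv ℝ (simplexFace i) t τ =
      Fin.tail (i.insertNth (α := fun _ => ℝ) 0 (dbary τ)) := by
    refine fderiv_apply_of_hasDerivAt (differentiable_simplexFace i t)
      (hasDerivAt_pi.2 fun j => ?_)
    simp only [simplexFace, Fin.tail]
    rcases Fin.eq_self_or_eq_succAbove i j.succ with h | ⟨k, h⟩
    · simp only [h, Fin.insertNth_apply_same]
      exact hasDerivAt_const _ _
    · simp only [h, Fin.insertNth_apply_succAbove]
      exact hasDerivAt_bary t τ k
  rw [h]
  refine dbary_eq_of_sum ?_
  simp [Fin.sum_univ_succAbove _ i, sum_dbary]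

/-- The face operators of `N\bar G`, omitting the entry `g_i`. -/
def faceBar (n : ℕ) {p : ℕ} (i : Fin (p + 2)) : Amb n (p + 2) →L[ℝ] Amb n (p + 1) :=
  ContinuousLinearMap.pi fun j => ContinuousLinearMap.proj (i.succAbove j)

lemma faceBar_apply (n : ℕ) {p : ℕ} (i : Fin (p + 2)) (g : Amb n (p + 2)) (j : Fin (p + 1)) :
    faceBar n i g j = g (i.succAbove j) := rfl

lemma faceBar_mem (n : ℕ) {p : ℕ} (i : Fin (p + 2)) {g : Amb n (p + 2)}
    (hg : g ∈ GLpow n (p + 2)) : faceBar n i g ∈ GLpow n (p + 1) := fun _ => hg _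

/-- Multiplying adjacent entries cancels the omitted vertex: (g_{i-1} g_i⁻¹)(g_i g_{i+1}⁻¹) =
g_{i-1} g_{i+1}⁻¹. -/
lemma face_gammaMap {n p : ℕ} (i : Fin (p + 2)) {g : Amb n (p + 2)} (hg : g ∈ GLpow n (p + 2)) :
    face n i (gammaMap n (p + 1) g) = gammaMap n p (faceBar n i g) := by
  funext j
  have h1 : Ring.inverse (g j.castSucc.succ) * g j.succ.castSucc = 1 :=
    Ring.inverse_mul_cancel _ (hg _)
  simp only [face, gammaMap, faceBar_apply]
  split_ifs with h h'
  · rw [Fin.succAbove_of_castSucc_lt i j.castSucc (by simp [Fin.lt_def]; omega),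
      Fin.succAbove_of_castSucc_lt i j.succ (by simp [Fin.lt_def]; omega)]
    rfl
  · rw [Fin.succAbove_of_castSucc_lt i j.castSucc (by simp [Fin.lt_def]; omega),
      Fin.succAbove_of_le_castSucc i j.succ (by simp [Fin.le_def]; omega), mul_assoc,
      ← mul_assoc (Ring.inverse _), h1, one_mul]
  · rw [Fin.succAbove_of_le_castSucc i j.castSucc (by simp [Fin.le_def]; omega),
      Fin.succAbove_of_le_castSucc i j.succ (by simp [Fin.le_def]; omega)]
    rfl

lemma fderiv_face_gammaMap {n p : ℕ} (i : Fin (p + 2)) {g : Amb n (p + 2)}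
    (hg : g ∈ GLpow n (p + 2)) (v : Amb n (p + 2)) :
    fderiv ℝ (face n i) (gammaMap n (p + 1) g) (fderiv ℝ (gammaMap n (p + 1)) g v) =
      fderiv ℝ (gammaMap n p) (faceBar n i g) (faceBar n i v) := by
  rw [fderiv_fderiv_apply (isOpen_GLpow n (p + 2)) hg
    ((contDiff_face n i).differentiable (by simp) _)
    (differentiableAt_of_contDiffOn_GLpow (contDiffOn_gammaMap n _) hg)
    fun y hy => face_gammaMap i hy,
    ← fderiv_fderiv_apply (f := faceBar n i) (g := gammaMap n p) isOpen_univ (Set.mem_univ g)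
    (differentiableAt_of_contDiffOn_GLpow (contDiffOn_gammaMap n p) (faceBar_mem n i hg))
    (faceBar n i).differentiableAt fun y _ => rfl, ContinuousLinearMap.fderiv]

lemma chernForm_face {n p : ℕ} (i : Fin (p + 2)) (t : Fin p → ℝ) {g : Amb n (p + 2)}
    (hg : g ∈ GLpow n (p + 2)) (v : Fin 4 → (Fin p → ℝ) × Amb n (p + 2)) :
    chernForm n (p + 1) (simplexFace i t, g)
        (fun k => (fderiv ℝ (simplexFace i) t (v k).1, (v k).2)) =
      chernForm n p (t, faceBar n i g) fun k => ((v k).1, faceBar n i (v k).2) := by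
  refine chernForm_eq (u := 1) (u' := 1) (one_mul 1) fun k l => ?_
  rw [curvature_apply hg, curvature_apply (faceBar_mem n i hg)]
  simp only [Matrix.cons_val_zero, Matrix.cons_val_one, bary_simplexFace,
    dbary_fderiv_simplexFace, curv_insertNth, one_mul, mul_one]
  rfl

/-- Compatibility is tested after pullback under id × γ, where both sides become values of c_2(Ω) on
N\bar G and agree by `chernForm_face`. -/
lemma isChernWeilForm_chernSFam (n : ℕ) : IsChernWeilForm (chern2 n) (chernSFam n) := by
  refine ⟨⟨chernSFam_mem n, fun p i => ?_⟩, fun p => ?_⟩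
  · funext x
    by_cases hx : x ∈ simplex p ×ˢ GLpow n (p + 1)
    swap
    · rw [pullback, pullback, Set.indicator_of_notMem hx, Set.indicator_of_notMem hx]
    refine eq_of_pullback_gammaMap (D := simplex p) (fun y hy v => ?_) x hx
    have hy' : (y.1, gammaMap n (p + 1) y.2) ∈ simplex p ×ˢ GLpow n (p + 1) :=
      ⟨hy.1, mapsTo_gammaMap n _ hy.2⟩
    have h1 := chernSFam_gammaMap (x := (simplexFace i y.1, y.2)) ⟨simplexFace_mem i hy.1, hy.2⟩
      fun k => (fderiv ℝ (simplexFace i) y.1 (v k).1, (v k).2)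
    have h2 := chernSFam_gammaMap (x := (y.1, faceBar n i y.2)) ⟨hy.1, faceBar_mem n i hy.2⟩
      fun k => ((v k).1, faceBar n i (v k).2)
    have h3 := chernForm_face i y.1 hy.2 v
    dsimp only at h1 h2
    rw [pullback_apply _ _ hy', pullback_apply _ _ hy']
    simp only [fderiv_prodMap_id_right (x := (y.1, gammaMap n (p + 1) y.2))
      (differentiable_simplexFace i y.1),
      fderiv_prodMap_id (x := (y.1, gammaMap n (p + 1) y.2))
      ((contDiff_face n i).differentiable (by simp) _), Prod.map_apply, id,
      fderiv_face_gammaMap i hy.2, face_gammaMap i hy.2]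
    rw [h1, h2, h3]
  · funext x
    by_cases hx : x ∈ simplex p ×ˢ GLpow n (p + 1)
    · rw [Set.indicator_of_mem hx]
      ext v
      rw [pullback_gammaMap_apply _ hx, chernSFam_gammaMap hx]
      rfl
    · rw [pullback, Set.indicator_of_notMem hx, Set.indicator_of_notMem hx]

lemma IsChernWeilForm.eq {n : ℕ} {P : Pairing (Mat n) (Mat n) ℂ} {φ ψ : SFam n 4}
    (hφ : IsChernWeilForm P φ) (hψ : IsChernWeilForm P ψ) : φ = ψ := by
  funext p x
  by_cases hx : x ∈ simplex p ×ˢ GLpow n p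
  · refine eq_of_pullback_gammaMap (D := simplex p) (fun y hy v => ?_) x hx
    rw [← pullback_gammaMap_apply (φ p) hy, ← pullback_gammaMap_apply (ψ p) hy, hφ.2 p, hψ.2 p]
  · rw [(hφ.1.smooth p).2 x hx, (hψ.1.smooth p).2 x hx]

/-! ### Explicit values of the forms `c_{1,3}` and `c_{2,2}` -/

/-- The constant `(1/2πi)²`. -/
def chernConst : ℂ := (1 / (2 * Real.pi * Complex.I)) ^ 2

/-- Cyclicity of the trace groups the six terms of the cube into two classes of three, turning −1/6
into −1/2. -/
lemma c13_apply {n : ℕ} {h : Amb n 1} (hh : h ∈ GLpow n 1) (v : Fin 3 → Amb n 1) :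
    c13 n h v = chernConst * (-1 / 2) *
      (tr n (Ring.inverse (h 0) * v 0 0 * (Ring.inverse (h 0) * v 1 0) *
          (Ring.inverse (h 0) * v 2 0)) -
        tr n (Ring.inverse (h 0) * v 0 0 * (Ring.inverse (h 0) * v 2 0) *
          (Ring.inverse (h 0) * v 1 0))) := by
  have h1 : c13 n h v = chernConst * (-1 / 6) *
      tr n (matWedge (matWedge (mulDiff n 1 (Ring.inverse (h 0)) 0 1)
        (mulDiff n 1 (Ring.inverse (h 0)) 0 1)) (mulDiff n 1 (Ring.inverse (h 0)) 0 1) v) := by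
    rw [c13, Set.indicator_of_mem hh]
    rfl
  rw [h1, matWedge, wedge_two_one]
  simp only [matWedge, wedge_one_one, mulDiff_apply, ContinuousLinearMap.mul_apply', mul_one,
    Matrix.cons_val_zero, Matrix.cons_val_one, map_sub, map_add, sub_apply]
  generalize Ring.inverse (h 0) * v 0 0 = a
  generalize Ring.inverse (h 0) * v 1 0 = b
  generalize Ring.inverse (h 0) * v 2 0 = c
  rw [show tr n (b * a * c) = tr n (a * c * b) by rw [mul_assoc, tr_mul_comm],
    show tr n (c * a * b) = tr n (a * b * c) by rw [mul_assoc, tr_mul_comm],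
    show tr n (b * c * a) = tr n (a * b * c) by rw [tr_mul_comm, mul_assoc],
    show tr n (c * b * a) = tr n (a * c * b) by rw [tr_mul_comm, mul_assoc]]
  ring

lemma c22_apply {n : ℕ} {h : Amb n 2} (hh : h ∈ GLpow n 2) (v : Fin 2 → Amb n 2) :
    c22 n h v = chernConst * (1 / 2) *
      (tr n (v 0 0 * (v 1 1 * (Ring.inverse (h 1) * Ring.inverse (h 0)))) -
        tr n (v 1 0 * (v 0 1 * (Ring.inverse (h 1) * Ring.inverse (h 0)))) -
        (tr n (Ring.inverse (h 0) * v 0 0) * tr n (Ring.inverse (h 1) * v 1 1) -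
          tr n (Ring.inverse (h 0) * v 1 0) * tr n (Ring.inverse (h 1) * v 0 1))) := by
  have h1 : c22 n h v = chernConst * (1 / 2) * tr n (matWedge (mulDiff n 2 1 0 1)
        (mulDiff n 2 1 1 (Ring.inverse (h 1) * Ring.inverse (h 0))) v) -
      chernConst * (1 / 2) * wedge (ContinuousLinearMap.mul ℝ ℂ)
        (trForm (mulDiff n 2 (Ring.inverse (h 0)) 0 1))
        (trForm (mulDiff n 2 (Ring.inverse (h 1)) 1 1)) v := by
    rw [c22, Set.indicator_of_mem hh]
    rfl
  have h2 (A : Mat n) (i : Fin 2) (w : Fin 1 → Amb n 2) :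
      trForm (mulDiff n 2 A i 1) w = tr n (A * w 0 i) := by
    rw [← mul_one (A * w 0 i)]
    rfl
  rw [h1, matWedge, wedge_one_one, wedge_one_one]
  simp only [h2, mulDiff_apply, ContinuousLinearMap.mul_apply', mul_one, one_mul,
    Matrix.cons_val_zero, map_sub]
  ring

lemma contDiffOn_inverse_apply (n p : ℕ) (i : Fin p) :
    ContDiffOn ℝ ∞ (fun h : Amb n p => Ring.inverse (h i)) (GLpow n p) :=
  contDiffOn_inverse (contDiff_apply ℝ (Mat n) i).contDiffOn fun _ hh => hh i

lemma contDiffOn_tr {n : ℕ} {E : Type*} [NormedAddCommGroup E] [NormedSpace ℝ E] {f : E → Mat n}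
    {S : Set E} (hf : ContDiffOn ℝ ∞ f S) : ContDiffOn ℝ ∞ (fun x => tr n (f x)) S :=
  (tr n).contDiff.comp_contDiffOn hf

lemma c13_mem (n : ℕ) : c13 n ∈ Forms (GLpow n 1) 3 := by
  refine ⟨contDiffOn_of_apply fun v => ?_, fun x hx => by rw [c13, Set.indicator_of_notMem hx]⟩
  refine ContDiffOn.congr ?_ fun x hx => c13_apply hx v
  have h (w : Mat n) := (contDiffOn_inverse_apply n 1 0).mul (contDiffOn_const (c := w))
  exact contDiffOn_const.mul ((contDiffOn_tr (((h _).mul (h _)).mul (h _))).sub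
    (contDiffOn_tr (((h _).mul (h _)).mul (h _))))

lemma c22_mem (n : ℕ) : c22 n ∈ Forms (GLpow n 2) 2 := by
  refine ⟨contDiffOn_of_apply fun v => ?_, fun x hx => by rw [c22, Set.indicator_of_notMem hx]⟩
  refine ContDiffOn.congr ?_ fun x hx => c22_apply hx v
  have h (i : Fin 2) := contDiffOn_inverse_apply n 2 i
  have h1 (i : Fin 2) (w : Mat n) := contDiffOn_tr ((h i).mul (contDiffOn_const (c := w)))
  have h2 (v w : Mat n) := contDiffOn_tr ((contDiffOn_const (c := v)).mul
    ((contDiffOn_const (c := w)).mul ((h 1).mul (h 0))))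
  exact contDiffOn_const.mul (((h2 _ _).sub (h2 _ _)).sub
    (((h1 _ _).mul (h1 _ _)).sub ((h1 _ _).mul (h1 _ _))))

lemma chernCochain_mem (n : ℕ) : chernCochain n ∈ Cochain n 4 := by
  refine ⟨fun p q => ?_, fun p q h => ?_⟩ <;> unfold chernCochain <;> split
  · exact c13_mem n
  · exact c22_mem n
  · exact zero_mem _
  · omega
  · omega
  · rfl

/-! ### Derivatives of the face operators -/

lemma hasDerivAt_line {n p : ℕ} (h v : Amb n p) (i : Fin p) :
    HasDerivAt (fun s : ℝ => (h + s • v) i) (v i) 0 := by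
  simpa using ((hasDerivAt_id (0 : ℝ)).smul_const (v i)).const_add (h i)

lemma hasDerivAt_inverse_line {n p : ℕ} {h : Amb n p} (hh : h ∈ GLpow n p) (v : Amb n p)
    (i : Fin p) : HasDerivAt (fun s : ℝ => Ring.inverse ((h + s • v) i))
      (-(Ring.inverse (h i) * v i * Ring.inverse (h i))) 0 := by
  simpa using hasDerivAt_inverse (hasDerivAt_line h v i) (by simpa using hh i)

/-- Lets the explicit formulas, valid only on the open set of invertible tuples, replace the
indicator-defined forms when differentiating. -/
lemma hasDerivAt_of_eqOn_GLpow {n p : ℕ} {F : Type*} [NormedAddCommGroup F] [NormedSpace ℝ F]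
    {h : Amb n p} (hh : h ∈ GLpow n p) (v : Amb n p) {f g : Amb n p → F}
    (hfg : ∀ x ∈ GLpow n p, f x = g x) {d : F}
    (hg : HasDerivAt (fun s : ℝ => g (h + s • v)) d 0) :
    HasDerivAt (fun s : ℝ => f (h + s • v)) d 0 := by
  refine hg.congr_of_eventuallyEq ?_
  have hc : ContinuousAt (fun s : ℝ => h + s • v) 0 := by fun_prop
  filter_upwards [hc ((isOpen_GLpow n p).mem_nhds (by simpa using hh))] with s hs using hfg _ hs

lemma fderiv_face {n p : ℕ} (i : Fin (p + 2)) (h v : Amb n (p + 1)) (j : Fin p) :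
    fderiv ℝ (face n i) h v j =
      if (j : ℕ) + 1 < i then v j.castSucc
      else if (j : ℕ) + 1 = i then v j.castSucc * h j.succ + h j.castSucc * v j.succ
      else v j.succ := by
  have hd : HasDerivAt (fun s : ℝ => face n i (h + s • v)) (fun j : Fin p =>
      if (j : ℕ) + 1 < i then v j.castSucc
      else if (j : ℕ) + 1 = i then v j.castSucc * h j.succ + h j.castSucc * v j.succ
      else v j.succ) 0 := by
    refine hasDerivAt_pi.2 fun k => ?_
    unfold face
    split_ifs
    · exact hasDerivAt_line _ _ _
    · simpa using (hasDerivAt_line h v k.castSucc).fun_mul (hasDerivAt_line h v k.succ)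
    · exact hasDerivAt_line _ _ _
  rw [fderiv_apply_of_hasDerivAt ((contDiff_face n i).differentiable (by simp) h) hd]

lemma hasDerivAt_tr {n : ℕ} {f : ℝ → Mat n} {d : Mat n} {s : ℝ} (hf : HasDerivAt f d s) :
    HasDerivAt (fun r => tr n (f r)) (tr n d) s :=
  (tr n).hasFDerivAt.comp_hasDerivAt s hf

/-! ### The cocycle conditions -/

lemma tr_cycle3 {n : ℕ} (a b c : Mat n) : tr n (a * b * c) = tr n (b * c * a) := by
  rw [mul_assoc, tr_mul_comm]

lemma tr_cycle4 {n : ℕ} (a b c d : Mat n) : tr n (a * b * c * d) = tr n (b * c * d * a) := by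
  rw [mul_assoc a, mul_assoc a, tr_mul_comm]

lemma hasDerivAt_c13 {n : ℕ} {h : Amb n 1} (hh : h ∈ GLpow n 1) (u a b c : Amb n 1) :
    HasDerivAt (fun s : ℝ => c13 n (h + s • u) ![a, b, c])
      (chernConst * (1 / 2) *
        let U := Ring.inverse (h 0) * u 0
        let A := Ring.inverse (h 0) * a 0
        let B := Ring.inverse (h 0) * b 0
        let C := Ring.inverse (h 0) * c 0
        (tr n (U * A * B * C) + tr n (A * U * B * C) + tr n (A * B * U * C) -
          (tr n (U * A * C * B) + tr n (A * U * C * B) + tr n (A * C * U * B)))) 0 := by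
  refine hasDerivAt_of_eqOn_GLpow hh u (fun x hx => c13_apply hx _) ?_
  have h1 (w : Mat n) := (hasDerivAt_inverse_line hh u 0).mul_const w
  have h2 (x y z : Mat n) := hasDerivAt_tr (((h1 x).mul (h1 y)).mul (h1 z))
  have h3 := ((h2 (a 0) (b 0) (c 0)).sub (h2 (a 0) (c 0) (b 0))).const_mul (chernConst * (-1 / 2))
  refine h3.congr_deriv (Eq.symm ?_)
  · simp only [zero_smul, Pi.zero_apply, add_zero, Pi.mul_apply, Pi.add_apply, add_mul, mul_neg, neg_mul, map_add,
      map_neg, ← mul_assoc]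
    ring

/-- Up to a constant, d tr(μ³) is tr(μ⁴). Moving one factor cyclically past the other three is odd
on forms but leaves the trace unchanged, so tr(μ⁴) = 0; rotating X to the front displays the
cancellation. -/
lemma dOn_c13 (n : ℕ) : dOn (GLpow n 1) (c13 n) = 0 := by
  funext h
  by_cases hh : h ∈ GLpow n 1
  swap
  · rw [dOn, Set.indicator_of_notMem hh]; rfl
  rw [dOn, Set.indicator_of_mem hh]
  ext v
  rw [extDeriv_three_apply (differentiableAt_of_contDiffOn_GLpow (c13_mem n).1 hh)
    (hasDerivAt_c13 hh _ _ _ _) (hasDerivAt_c13 hh _ _ _ _) (hasDerivAt_c13 hh _ _ _ _)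
    (hasDerivAt_c13 hh _ _ _ _)]
  dsimp only
  generalize Ring.inverse (h 0) * v 0 0 = X
  generalize Ring.inverse (h 0) * v 1 0 = Y
  generalize Ring.inverse (h 0) * v 2 0 = Z
  generalize Ring.inverse (h 0) * v 3 0 = W
  have e1 (a b c : Mat n) : tr n (a * X * b * c) = tr n (X * b * c * a) := tr_cycle4 _ _ _ _
  have e2 (a b c : Mat n) : tr n (a * b * X * c) = tr n (X * c * a * b) := by
    rw [tr_cycle4, tr_cycle4]
  simp only [e1, e2]
  ring_nf
  rfl

/-- By cyclicity tr(dh_1 dh_2 h_2⁻¹ h_1⁻¹) = tr(PQ) with P left invariant in h_1 and Q right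
invariant in h_2. These are also the variables in which the three faces of c_{1,3} are simple. -/
lemma hasDerivAt_c22 {n : ℕ} {h : Amb n 2} (hh : h ∈ GLpow n 2) (u a b : Amb n 2) :
    HasDerivAt (fun s : ℝ => c22 n (h + s • u) ![a, b])
      (chernConst * (1 / 2) *
        let Pu := Ring.inverse (h 0) * u 0
        let Pa := Ring.inverse (h 0) * a 0
        let Pb := Ring.inverse (h 0) * b 0
        let Qu := u 1 * Ring.inverse (h 1)
        let Qa := a 1 * Ring.inverse (h 1)
        let Qb := b 1 * Ring.inverse (h 1)
        (-(tr n (Pa * Qb * Qu) + tr n (Pa * Qb * Pu)) + (tr n (Pb * Qa * Qu) + tr n (Pb * Qa * Pu)) +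
          (tr n (Pu * Pa) * tr n Qb + tr n Pa * tr n (Qu * Qb) -
            (tr n (Pu * Pb) * tr n Qa + tr n Pb * tr n (Qu * Qa))))) 0 := by
  refine hasDerivAt_of_eqOn_GLpow hh u (fun x hx => c22_apply hx _) ?_
  have h0 (i : Fin 2) := hasDerivAt_inverse_line hh u i
  have h1 (i : Fin 2) (w : Mat n) := hasDerivAt_tr ((h0 i).mul_const w)
  have h2 (x y : Mat n) := hasDerivAt_tr ((((h0 1).mul (h0 0)).const_mul y).const_mul x)
  have h3 := (((h2 (a 0) (b 1)).sub (h2 (b 0) (a 1))).sub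
    (((h1 0 (a 0)).mul (h1 1 (b 1))).sub ((h1 0 (b 0)).mul (h1 1 (a 1))))).const_mul
      (chernConst * (1 / 2))
  refine h3.congr_deriv (Eq.symm ?_)
  · have e1 (a : Mat n) :
        tr n (a * Ring.inverse (h 0)) = tr n (Ring.inverse (h 0) * a) := tr_mul_comm _ _
    have e2 (a : Mat n) :
        tr n (a * Ring.inverse (h 1)) = tr n (Ring.inverse (h 1) * a) := tr_mul_comm _ _
    simp only [zero_smul, Pi.zero_apply, add_zero, Pi.add_apply, mul_add, mul_neg, neg_mul,
      map_add, map_neg, ← mul_assoc, e1, e2]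
    ring

lemma dPrime_apply {n p q : ℕ} (c : Fam n) {h : Amb n (p + 1)} (hh : h ∈ GLpow n (p + 1))
    (v : Fin q → Amb n (p + 1)) : dPrime n c (p + 1) q h v = ∑ i : Fin (p + 2),
      (-1 : ℂ) ^ (i : ℕ) * c p q (face n i h) fun j => fderiv ℝ (face n i) h (v j) := by
  simp only [dPrime, Finset.sum_apply, ContinuousAlternatingMap.sum_apply, Pi.smul_apply,
    ContinuousAlternatingMap.smul_apply, pullback_apply _ _ hh, smul_eq_mul]

lemma tr_conj3 {n : ℕ} {u u' : Mat n} (h : u * u' = 1) (A B C : Mat n) :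
    tr n (u' * A * u * (u' * B * u) * (u' * C * u)) = tr n (A * B * C) := by
  have e : u' * A * u * (u' * B * u) * (u' * C * u) =
      u' * (A * (u * u') * B * (u * u') * C * u) := by noncomm_ring
  rw [e, tr_mul_comm, h, mul_one, mul_one, mul_assoc _ u, h, mul_one]

/-- After conjugation the faces contribute tr Q³ − tr (P + Q)³ + tr P³. The mixed terms left over
are cancelled by the differential of tr(PQ), while tr P ∧ tr Q is closed. -/
lemma dPrime_c13_add_dSecond_c22 (n : ℕ) :
    dPrime n (chernCochain n) 2 3 + dSecond n (chernCochain n) 2 3 = 0 := by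
  funext h
  by_cases hh : h ∈ GLpow n 2
  swap
  · exact ((total_mem n (chernCochain_mem n)).1 2 3).2 h hh
  ext v
  have hd : dSecond n (chernCochain n) 2 3 h v = extDeriv (c22 n) h v := by
    simp [dSecond, chernCochain, dOn, hh]
  have hp : dPrime n (chernCochain n) 2 3 h v =
      c13 n (face n 0 h) (fun i => fderiv ℝ (face n 0) h (v i))
      - c13 n (face n 1 h) (fun i => fderiv ℝ (face n 1) h (v i))
      + c13 n (face n 2 h) (fun i => fderiv ℝ (face n 2) h (v i)) := by
    rw [dPrime_apply _ hh]
    simp [Fin.sum_univ_three, sub_eq_add_neg, chernCochain]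
  have hu : h 1 * Ring.inverse (h 1) = 1 := Ring.mul_inverse_cancel _ (hh 1)
  -- Written as a conjugate of Q by h_2, to match the shape of the product face, so that `tr_conj3`
  -- removes both conjugations.
  have f0 (w : Amb n 2) : Ring.inverse (face n 0 h 0) * fderiv ℝ (face n 0) h w 0 =
      Ring.inverse (h 1) * (w 1 * Ring.inverse (h 1)) * h 1 := by
    rw [mul_assoc, mul_assoc, Ring.inverse_mul_cancel _ (hh 1), mul_one]
    simp [fderiv_face, face]
  have f1 (w : Amb n 2) : Ring.inverse (face n 1 h 0) * fderiv ℝ (face n 1) h w 0 =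
      Ring.inverse (h 1) * (Ring.inverse (h 0) * w 0 + w 1 * Ring.inverse (h 1)) * h 1 := by
    have e : Ring.inverse (face n 1 h 0) * fderiv ℝ (face n 1) h w 0 =
        Ring.inverse (h 0 * h 1) * (w 0 * h 1 + h 0 * w 1) := by
      simp [fderiv_face, face]
    have e1 : Ring.inverse (h 1) * Ring.inverse (h 0) * (h 0 * w 1) =
        Ring.inverse (h 1) * (Ring.inverse (h 0) * h 0) * w 1 := by noncomm_ring
    rw [e, inverse_mul_eq (hh 0) (hh 1), mul_add, e1, Ring.inverse_mul_cancel _ (hh 0), mul_add,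
      add_mul, mul_assoc _ (w 1 * _), mul_assoc (w 1), Ring.inverse_mul_cancel _ (hh 1)]
    noncomm_ring
  have f2 (w : Amb n 2) : Ring.inverse (face n 2 h 0) * fderiv ℝ (face n 2) h w 0 =
      Ring.inverse (h 0) * w 0 := by
    simp [fderiv_face, face]
  rw [Pi.add_apply, ContinuousAlternatingMap.add_apply, hd, hp,
    extDeriv_two_apply (differentiableAt_of_contDiffOn_GLpow (c22_mem n).1 hh)
    (hasDerivAt_c22 hh _ _ _) (hasDerivAt_c22 hh _ _ _) (hasDerivAt_c22 hh _ _ _),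
    c13_apply (mapsTo_face n _ hh), c13_apply (mapsTo_face n _ hh), c13_apply (mapsTo_face n _ hh)]
  simp only [f0, f1, f2, tr_conj3 hu]
  generalize Ring.inverse (h 0) * v 0 0 = P₀
  generalize Ring.inverse (h 0) * v 1 0 = P₁
  generalize Ring.inverse (h 0) * v 2 0 = P₂
  generalize v 0 1 * Ring.inverse (h 1) = Q₀
  generalize v 1 1 * Ring.inverse (h 1) = Q₁
  generalize v 2 1 * Ring.inverse (h 1) = Q₂
  have e2 (a b : Mat n) : tr n (a * b * P₀) = tr n (P₀ * a * b) := (tr_cycle3 _ _ _).symm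
  have e3 (a c : Mat n) : tr n (a * Q₀ * c) = tr n (Q₀ * c * a) := tr_cycle3 _ _ _
  have e4 (a b : Mat n) : tr n (a * b * Q₀) = tr n (Q₀ * a * b) := (tr_cycle3 _ _ _).symm
  simp only [mul_add, add_mul, map_add, e2, e3, e4, tr_mul_comm _ P₀, tr_mul_comm _ Q₀,
    tr_mul_comm P₂ P₁, tr_mul_comm Q₂ Q₁]
  ring_nf
  rfl

/-- The form tr(h⁻¹dh) is additive under products, so the product of traces is a cocycle. For the
other part, faces 1 and 2 each split by the Leibniz rule into one outer-face term and one common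
middle term; all of these cancel. -/
lemma dPrime_c22 (n : ℕ) : dPrime n (chernCochain n) 3 2 = 0 := by
  funext h
  by_cases hh : h ∈ GLpow n 3
  swap
  -- Off the invertible tuples the total differential vanishes, and so does d'', leaving d' = 0.
  · have h1 := ((total_mem n (chernCochain_mem n)).1 3 2).2 h hh
    have h2 : dSecond n (chernCochain n) 3 2 h = 0 := by simp [dSecond, dOn, hh]
    rwa [Pi.add_apply, Pi.add_apply, Pi.add_apply, h2, add_zero] at h1
  ext v
  have h0 : Ring.inverse (h 0) * h 0 = 1 := Ring.inverse_mul_cancel _ (hh 0)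
  have h2 (x : Mat n) : h 2 * (Ring.inverse (h 2) * x) = x := by
    rw [← mul_assoc, Ring.mul_inverse_cancel _ (hh 2), one_mul]
  have a1 (x y w : Mat n) : tr n ((x * h 1 + h 0 * y) *
      (w * (Ring.inverse (h 2) * Ring.inverse (h 0 * h 1)))) =
      tr n (x * h 1 * w * Ring.inverse (h 2) * Ring.inverse (h 1) * Ring.inverse (h 0)) +
        tr n (y * (w * (Ring.inverse (h 2) * Ring.inverse (h 1)))) := by
    rw [inverse_mul_eq (hh 0) (hh 1), add_mul, map_add, mul_assoc (h 0), tr_mul_comm (h 0)]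
    simp only [mul_assoc, h0, mul_one]
  have a2 (x y w : Mat n) : tr n (x * ((y * h 2 + h 1 * w) *
      (Ring.inverse (h 1 * h 2) * Ring.inverse (h 0)))) =
      tr n (x * (y * (Ring.inverse (h 1) * Ring.inverse (h 0)))) +
      tr n (x * h 1 * w * Ring.inverse (h 2) * Ring.inverse (h 1) * Ring.inverse (h 0)) := by
    rw [inverse_mul_eq (hh 1) (hh 2), add_mul, mul_add, map_add]
    simp only [mul_assoc, h2]
  have a3 {g g' : Mat n} (hg : IsUnit g) (hg' : IsUnit g') (x y : Mat n) :
      tr n (Ring.inverse (g * g') * (x * g' + g * y)) =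
        tr n (Ring.inverse g * x) + tr n (Ring.inverse g' * y) := by
    rw [inverse_mul_eq hg hg', mul_add, map_add, mul_assoc, mul_assoc, tr_mul_comm, mul_assoc,
      mul_assoc, Ring.mul_inverse_cancel _ hg', mul_one, ← mul_assoc (Ring.inverse g) g,
      Ring.inverse_mul_cancel _ hg, one_mul]
  rw [dPrime_apply _ hh, Fin.sum_univ_four]
  simp only [chernCochain]
  rw [c22_apply (mapsTo_face n _ hh), c22_apply (mapsTo_face n _ hh),
    c22_apply (mapsTo_face n _ hh), c22_apply (mapsTo_face n _ hh)]
  simp [fderiv_face, face, a1, a2, a3 (hh 0) (hh 1), a3 (hh 1) (hh 2)]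
  ring

lemma dSecond_c13 (n : ℕ) : dSecond n (chernCochain n) 1 4 = 0 := by
  simp only [dSecond, chernCochain, dOn_c13, smul_zero]

lemma chernCochain_mem_cocycle (n : ℕ) : chernCochain n ∈ Cocycle n 4 := by
  refine ⟨⟨chernCochain n, chernCochain_mem n⟩, LinearMap.mem_ker.2 (Subtype.ext ?_), rfl⟩
  change dPrime n (chernCochain n) + dSecond n (chernCochain n) = 0
  funext p q
  by_cases hpq : p + q = 5
  swap
  · exact (total_mem n (chernCochain_mem n)).2 p q hpq
  have hp : p ≤ 5 := by omega
  change dPrime n (chernCochain n) p q + dSecond n (chernCochain n) p q = 0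
  interval_cases p
  · obtain rfl : q = 5 := by omega
    simp [dPrime, dSecond, chernCochain, dOn_zero]
  · obtain rfl : q = 4 := by omega
    rw [dSecond_c13]
    simp [dPrime, chernCochain, pullback_zero]
  · obtain rfl : q = 3 := by omega
    exact dPrime_c13_add_dSecond_c22 n
  · obtain rfl : q = 2 := by omega
    rw [dPrime_c22]
    simp [dSecond, chernCochain, dOn_zero]
  · obtain rfl : q = 1 := by omega
    simp [dPrime, dSecond, chernCochain, dOn_zero, pullback_zero]
  · obtain rfl : q = 0 := by omega
    simp [dPrime, dSecond, chernCochain, pullback_zero]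

/-! ### Integrals over the standard simplices -/

lemma isClosed_simplex (p : ℕ) : IsClosed (simplex p) := by
  have h : simplex p = (⋂ i, {t : Fin p → ℝ | 0 ≤ t i}) ∩ {t | ∑ i, t i ≤ 1} := by
    ext t; simp [simplex]
  rw [h]
  exact (isClosed_iInter fun i => isClosed_le continuous_const (continuous_apply i)).inter
    (isClosed_le (by fun_prop) continuous_const)

open MeasureTheory in
lemma integral_simplex_one : ∫ t in simplex 1, ((t 0) ^ 2 - t 0) = -1 / 6 := by
  have h : simplex 1 = MeasurableEquiv.funUnique (Fin 1) ℝ ⁻¹' Set.Icc 0 1 := by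
    ext t; simp [simplex]
  have h1 := (volume_preserving_funUnique (Fin 1) ℝ).setIntegral_preimage_emb
    (MeasurableEquiv.measurableEmbedding _) (fun x : ℝ => x ^ 2 - x) (Set.Icc 0 1)
  rw [h]
  refine Eq.trans ?_ (h1.trans ?_)
  · rfl
  · rw [integral_Icc_eq_integral_Ioc, ← intervalIntegral.integral_of_le zero_le_one,
      intervalIntegral.integral_sub (by simp) (by simp), integral_pow, integral_id]
    norm_num

open MeasureTheory in
lemma volume_simplex_two : (volume : Measure (Fin 2 → ℝ)).real (simplex 2) = 1 / 2 := by
  let T : Set (ℝ × ℝ) := {x | (0 ≤ x.1 ∧ 0 ≤ x.2) ∧ x.1 + x.2 ≤ 1}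
  have h : simplex 2 = MeasurableEquiv.finTwoArrow ⁻¹' T := by
    ext t; simp [simplex, T, Fin.forall_fin_two]
  have hT : MeasurableSet T := by
    refine IsClosed.measurableSet ?_
    exact ((isClosed_le continuous_const continuous_fst).inter
      (isClosed_le continuous_const continuous_snd)).inter
        (isClosed_le (continuous_fst.add continuous_snd) continuous_const)
  have h1 : volume T = ENNReal.ofReal (1 / 2) := by
    have h2 (x : ℝ) : volume (Prod.mk x ⁻¹' T) =
        (Set.Icc (0 : ℝ) 1).indicator (fun x => ENNReal.ofReal (1 - x)) x := by
      by_cases hx : x ∈ Set.Icc (0 : ℝ) 1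
      · rw [Set.indicator_of_mem hx]
        have : Prod.mk x ⁻¹' T = Set.Icc 0 (1 - x) := by
          ext y
          simp only [T, Set.mem_preimage, Set.mem_ofPred_eq, Set.mem_Icc]
          constructor
          · rintro ⟨⟨_, h⟩, h'⟩; exact ⟨h, by linarith⟩
          · rintro ⟨h, h'⟩; exact ⟨⟨hx.1, h⟩, by linarith⟩
        rw [this, Real.volume_Icc, sub_zero]
      · rw [Set.indicator_of_notMem hx]
        have : Prod.mk x ⁻¹' T = ∅ := by
          ext y
          simp only [T, Set.mem_preimage, Set.mem_ofPred_eq, Set.mem_empty_iff_false, iff_false]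
          rintro ⟨⟨h, h''⟩, h'⟩
          exact hx ⟨h, by linarith⟩
        rw [this, measure_empty]
    rw [Measure.volume_eq_prod, Measure.prod_apply hT]
    simp only [h2]
    rw [lintegral_indicator measurableSet_Icc, ← ofReal_integral_eq_lintegral_ofReal]
    · congr 1
      rw [integral_Icc_eq_integral_Ioc, ← intervalIntegral.integral_of_le zero_le_one,
        intervalIntegral.integral_sub (by simp) (by simp), integral_id]
      norm_num
    · exact (by fun_prop : Continuous fun x : ℝ => 1 - x).integrableOn_Icc
    · filter_upwards [ae_restrict_mem measurableSet_Icc] with x hx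
      simpa using hx.2
  rw [h, measureReal_def, (volume_preserving_finTwoArrow ℝ).measure_preimage hT.nullMeasurableSet,
    h1, ENNReal.toReal_ofReal (by norm_num)]

/-! ### The integral of `c_2(Ω)` over the simplices -/

/-- The value of `g_i⁻¹ dg_i`, pulled back by the section of `γ`, on the vector `w`. -/
def sectionMC {n p : ℕ} (h w : Amb n p) (i : Fin (p + 1)) : Mat n :=
  Ring.inverse (gammaSection n p h i) * fderiv ℝ (gammaSection n p) h w i

/-- With g_i = P_i⁻¹ one has g_i⁻¹ dg_i = P_i d(P_i⁻¹) = −dP_i P_i⁻¹. -/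
lemma sectionMC_eq {n p : ℕ} {h : Amb n p} (hh : h ∈ GLpow n p) (w : Amb n p) (i : Fin (p + 1))
    {d : Mat n} (hd : HasDerivAt (fun s : ℝ => Fin.partialProd (h + s • w) i) d 0) :
    sectionMC h w i = -(d * Ring.inverse (Fin.partialProd h i)) := by
  have h0 := differentiableAt_of_contDiffOn_GLpow (contDiffOn_gammaSection n p) hh
  have h1 := hasDerivAt_inverse hd (by simpa using isUnit_partialProd hh i)
  have h2 : HasDerivAt (fun s : ℝ => gammaSection n p (h + s • w) i)
      (fderiv ℝ (gammaSection n p) h w i) 0 := by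
    have h3 : HasDerivAt (fun s : ℝ => h + s • w) w 0 := by
      simpa using ((hasDerivAt_id (0 : ℝ)).smul_const w).const_add h
    have h4 : HasFDerivAt (gammaSection n p) (fderiv ℝ (gammaSection n p) h) (h + (0 : ℝ) • w) := by
      simpa using h0.hasFDerivAt
    exact hasDerivAt_pi.1 (h4.comp_hasDerivAt (0 : ℝ) h3) i
  have hu := isUnit_partialProd hh i
  rw [sectionMC, h2.unique h1, gammaSection, inverse_inverse_eq hu]
  simp only [zero_smul, add_zero, mul_neg]
  rw [← mul_assoc, ← mul_assoc, Ring.mul_inverse_cancel _ hu, one_mul]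

lemma sectionMC_zero {n p : ℕ} {h : Amb n p} (hh : h ∈ GLpow n p) (w : Amb n p) :
    sectionMC h w 0 = 0 := by
  rw [sectionMC_eq hh w 0 (d := 0) (by simpa using hasDerivAt_const _ _), zero_mul, neg_zero]

lemma partialProd_one {n p : ℕ} (h : Amb n (p + 1)) : Fin.partialProd h 1 = h 0 := by
  rw [← Fin.succ_zero_eq_one, Fin.partialProd_succ]
  simp

lemma partialProd_two {n : ℕ} (h : Amb n 2) : Fin.partialProd h 2 = h 0 * h 1 := by
  rw [show (2 : Fin 3) = Fin.succ 1 from rfl, Fin.partialProd_succ]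
  congr 1
  exact partialProd_one h

lemma sectionMC_one {n p : ℕ} {h : Amb n (p + 1)} (hh : h ∈ GLpow n (p + 1)) (w : Amb n (p + 1)) :
    sectionMC h w 1 = -(w 0 * Ring.inverse (h 0)) := by
  rw [sectionMC_eq hh w 1 (d := w 0) (by simpa only [partialProd_one] using hasDerivAt_line h w 0),
    partialProd_one]

lemma sectionMC_two {n : ℕ} {h : Amb n 2} (hh : h ∈ GLpow n 2) (w : Amb n 2) :
    sectionMC h w 2 = -((w 0 * h 1 + h 0 * w 1) * (Ring.inverse (h 1) * Ring.inverse (h 0))) := by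
  rw [sectionMC_eq hh w 2 (d := w 0 * h 1 + h 0 * w 1), partialProd_two,
    inverse_mul_eq (hh 0) (hh 1)]
  simpa only [partialProd_two, zero_smul, add_zero] using
    (hasDerivAt_line h w 0).fun_mul (hasDerivAt_line h w 1)

/-- The curvature pulled back by the section of `γ`. -/
def sectionCurvature (n p : ℕ) (t : Fin p → ℝ) (h : Amb n p) (v w : (Fin p → ℝ) × Amb n p) :
    Mat n :=
  curvature n p (t, gammaSection n p h) ![(v.1, fderiv ℝ (gammaSection n p) h v.2),
    (w.1, fderiv ℝ (gammaSection n p) h w.2)]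

lemma sectionCurvature_eq {n p : ℕ} (t : Fin p → ℝ) {h : Amb n p} (hh : h ∈ GLpow n p)
    (v w : (Fin p → ℝ) × Amb n p) : sectionCurvature n p t h v w =
      curv (bary t) (dbary v.1) (dbary w.1) (sectionMC h v.2) (sectionMC h w.2) :=
  curvature_apply (mapsTo_gammaSection n p hh) _

lemma chernSFam_apply_sectionCurvature {n p : ℕ} {t : Fin p → ℝ} (ht : t ∈ simplex p)
    {h : Amb n p} (hh : h ∈ GLpow n p) (v : Fin 4 → (Fin p → ℝ) × Amb n p) :
    chernSFam n p (t, h) v = (2 : ℝ) •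
      (chern2 n (sectionCurvature n p t h (v 0) (v 1)) (sectionCurvature n p t h (v 2) (v 3))
      - chern2 n (sectionCurvature n p t h (v 0) (v 2)) (sectionCurvature n p t h (v 1) (v 3))
      + chern2 n (sectionCurvature n p t h (v 0) (v 3)) (sectionCurvature n p t h (v 1) (v 2))) := by
  rw [chernSFam_apply (x := (t, h)) ⟨ht, hh⟩, chernForm_apply]
  rfl

lemma sectionMC_apply_zero {n p : ℕ} (h : Amb n p) : sectionMC h 0 = fun _ => 0 := by
  funext i
  simp [sectionMC]

lemma dbary_zero {p : ℕ} : dbary (0 : Fin p → ℝ) = 0 := by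
  funext i
  refine Fin.cases ?_ (fun j => ?_) i <;> simp [dbary]

/-- Neither θ nor any θ_i has a dt component, and in dθ each dt_i is paired with a θ_i, so no dt∧dt
term arises. -/
lemma sectionCurvature_vertical {n p : ℕ} (t : Fin p → ℝ) {h : Amb n p} (hh : h ∈ GLpow n p)
    (τ τ' : Fin p → ℝ) : sectionCurvature n p t h (τ, 0) (τ', 0) = 0 := by
  rw [sectionCurvature_eq t hh]
  simp [sectionMC_apply_zero, curv]

/-- The coefficient of dt_k is θ_k − θ_0 because dt_0 = −∑ dt_k, and θ_0 = 0 on the section. It does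
not depend on t. -/
lemma sectionCurvature_mixed {n p : ℕ} (t : Fin p → ℝ) {h : Amb n p} (hh : h ∈ GLpow n p)
    (k : Fin p) (w : Amb n p) :
    sectionCurvature n p t h (Pi.single k 1, 0) (0, w) = sectionMC h w k.succ := by
  rw [sectionCurvature_eq t hh]
  simp [sectionMC_apply_zero, curv, Fin.sum_univ_succ, sectionMC_zero hh, dbary,
    Pi.single_apply, ite_smul]

lemma sectionCurvature_horizontal_zero {n : ℕ} (t : Fin 0 → ℝ) {h : Amb n 0} (hh : h ∈ GLpow n 0)
    (v w : Amb n 0) : sectionCurvature n 0 t h (0, v) (0, w) = 0 := by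
  rw [sectionCurvature_eq t hh]
  simp [curv, sectionMC_zero hh]

/-- On the section θ = t θ_1, so the horizontal part of dθ + θ∧θ is (−t + t²) θ_1∧θ_1. -/
lemma sectionCurvature_horizontal_one {n : ℕ} (t : Fin 1 → ℝ) {h : Amb n 1} (hh : h ∈ GLpow n 1)
    (v w : Amb n 1) : sectionCurvature n 1 t h (0, v) (0, w) = ((t 0) ^ 2 - t 0) •
      (sectionMC h v 1 * sectionMC h w 1 - sectionMC h w 1 * sectionMC h v 1) := by
  rw [sectionCurvature_eq t hh]
  simp [curv, dbary_zero, sectionMC_zero hh, Fin.sum_univ_two, bary, smul_smul]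
  module

/-! ### The fibre integrals, bidegree by bidegree -/

lemma fiberIntegral_apply {n k p q : ℕ} (φ : SFam n k) (hk : k = p + q) {h : Amb n p}
    (hh : h ∈ GLpow n p) : fiberIntegral φ p q h = ∫ t in simplex p,
      (insertFirst (fun i : Fin p => ((Pi.single i 1, 0) : (Fin p → ℝ) × Amb n p))
        (hk ▸ φ p (t, h) : AltForm ((Fin p → ℝ) × Amb n p) ℂ (p + q))).compContinuousLinearMap
          (ContinuousLinearMap.inr ℝ (Fin p → ℝ) (Amb n p)) := by
  rw [fiberIntegral, dif_pos hk, Set.indicator_of_mem hh]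

/-- If the integrand is `f • C` for a constant form `C` then so is the integral over the fiber. -/
lemma fiberIntegral_eq_of_forall {n p q : ℕ} (φ : SFam n (p + q)) {h : Amb n p}
    (hh : h ∈ GLpow n p) (f : (Fin p → ℝ) → ℝ) (C : AltForm (Amb n p) ℂ q)
    (hC : ∀ t ∈ simplex p, ∀ w : Fin q → Amb n p,
      φ p (t, h) (Fin.append (fun i : Fin p => ((Pi.single i 1, 0) : (Fin p → ℝ) × Amb n p))
        fun j => (0, w j)) = f t • C w) :
    fiberIntegral φ p q h = (∫ t in simplex p, f t) • C := by
  rw [fiberIntegral_apply φ rfl hh]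
  refine Eq.trans ?_ (integral_smul_const f C)
  refine MeasureTheory.setIntegral_congr_fun (isClosed_simplex p).measurableSet fun t ht => ?_
  ext w
  exact hC t ht w

lemma fiberIntegral_chernSFam_zero_four (n : ℕ) : fiberIntegral (chernSFam n) 0 4 = 0 := by
  funext h
  by_cases hh : h ∈ GLpow n 0
  swap
  · simp [fiberIntegral, hh]
  have key := fiberIntegral_eq_of_forall (p := 0) (q := 4) (chernSFam n) hh (fun _ => 0) 0 ?_
  · exact key.trans (by simp)
  intro t ht w
  refine (chernSFam_apply_sectionCurvature ht hh _).trans ?_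
  change (2 : ℝ) • (chern2 n (sectionCurvature n 0 t h (0, w 0) (0, w 1))
      (sectionCurvature n 0 t h (0, w 2) (0, w 3)) -
    chern2 n (sectionCurvature n 0 t h (0, w 0) (0, w 2))
      (sectionCurvature n 0 t h (0, w 1) (0, w 3)) +
    chern2 n (sectionCurvature n 0 t h (0, w 0) (0, w 3))
      (sectionCurvature n 0 t h (0, w 1) (0, w 2))) = _
  simp only [sectionCurvature_horizontal_zero t hh]
  simp

/-- However four vectors with three vertical ones are split into pairs, one pair is vertical, and
the curvature vanishes on it. -/
lemma fiberIntegral_chernSFam_three_one (n : ℕ) : fiberIntegral (chernSFam n) 3 1 = 0 := by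
  funext h
  by_cases hh : h ∈ GLpow n 3
  swap
  · simp [fiberIntegral, hh]
  have key := fiberIntegral_eq_of_forall (p := 3) (q := 1) (chernSFam n) hh (fun _ => 0) 0 ?_
  · exact key.trans (by simp)
  intro t ht w
  refine (chernSFam_apply_sectionCurvature ht hh _).trans ?_
  change (2 : ℝ) • (chern2 n (sectionCurvature n 3 t h (Pi.single 0 1, 0) (Pi.single 1 1, 0)) _ -
    chern2 n (sectionCurvature n 3 t h (Pi.single 0 1, 0) (Pi.single 2 1, 0)) _ +
    chern2 n _ (sectionCurvature n 3 t h (Pi.single 1 1, 0) (Pi.single 2 1, 0))) = _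
  simp only [sectionCurvature_vertical t hh]
  simp

lemma fiberIntegral_chernSFam_four_zero (n : ℕ) : fiberIntegral (chernSFam n) 4 0 = 0 := by
  funext h
  by_cases hh : h ∈ GLpow n 4
  swap
  · simp [fiberIntegral, hh]
  have key := fiberIntegral_eq_of_forall (p := 4) (q := 0) (chernSFam n) hh (fun _ => 0) 0 ?_
  · exact key.trans (by simp)
  intro t ht w
  refine (chernSFam_apply_sectionCurvature ht hh _).trans ?_
  change (2 : ℝ) • (chern2 n (sectionCurvature n 4 t h (Pi.single 0 1, 0) (Pi.single 1 1, 0)) _ -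
    chern2 n (sectionCurvature n 4 t h (Pi.single 0 1, 0) (Pi.single 2 1, 0)) _ +
    chern2 n _ (sectionCurvature n 4 t h (Pi.single 1 1, 0) (Pi.single 2 1, 0))) = _
  simp only [sectionCurvature_vertical t hh]
  simp

lemma fiberIntegral_chernSFam_one_three (n : ℕ) : fiberIntegral (chernSFam n) 1 3 = c13 n := by
  funext h
  by_cases hh : h ∈ GLpow n 1
  swap
  · simp [fiberIntegral, hh, c13]
  -- The factor −6 offsets the integral −1/6 of t² − t over [0, 1].
  have key := fiberIntegral_eq_of_forall (p := 1) (q := 3) (chernSFam n) hh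
    (fun t => (t 0) ^ 2 - t 0) ((-6 : ℝ) • c13 n h) ?_
  · exact key.trans (by rw [integral_simplex_one, smul_smul]; norm_num)
  intro t ht w
  refine (chernSFam_apply_sectionCurvature ht hh _).trans ?_
  change (2 : ℝ) • (chern2 n (sectionCurvature n 1 t h (Pi.single 0 1, 0) (0, w 0))
      (sectionCurvature n 1 t h (0, w 1) (0, w 2)) -
    chern2 n (sectionCurvature n 1 t h (Pi.single 0 1, 0) (0, w 1))
      (sectionCurvature n 1 t h (0, w 0) (0, w 2)) +
    chern2 n (sectionCurvature n 1 t h (Pi.single 0 1, 0) (0, w 2))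
      (sectionCurvature n 1 t h (0, w 0) (0, w 1))) = _
  have e1 (k : Fin 3) : sectionCurvature n 1 t h (Pi.single 0 1, 0) (0, w k) =
      -(w k 0 * Ring.inverse (h 0)) :=
    (sectionCurvature_mixed t hh 0 (w k)).trans (sectionMC_one hh (w k))
  rw [ContinuousAlternatingMap.smul_apply, c13_apply hh]
  simp only [e1, sectionCurvature_horizontal_one t hh, sectionMC_one hh, map_smul, neg_mul_neg]
  -- The section produces dh h⁻¹ while c_{1,3} is written with h⁻¹dh; cyclicity identifies the
  -- traces. The tr·tr part of c_2 drops out since one factor is the trace of a commutator.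
  have e2 (i j k : Fin 3) : tr n (Ring.inverse (h 0) * w i 0 * (Ring.inverse (h 0) * w j 0) *
      (Ring.inverse (h 0) * w k 0)) = tr n (w i 0 * Ring.inverse (h 0) *
        (w j 0 * Ring.inverse (h 0)) * (w k 0 * Ring.inverse (h 0))) := by
    simp only [mul_assoc]
    rw [tr_mul_comm]
    simp only [mul_assoc]
  simp only [e2]
  generalize w 0 0 * Ring.inverse (h 0) = A
  generalize w 1 0 * Ring.inverse (h 0) = B
  generalize w 2 0 * Ring.inverse (h 0) = C
  have e3 (a c : Mat n) : tr n (a * A * c) = tr n (A * c * a) := tr_cycle3 _ _ _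
  have e4 (a b : Mat n) : tr n (a * b * A) = tr n (A * a * b) := (tr_cycle3 _ _ _).symm
  simp only [chern2_apply]
  simp only [chernConst, mul_sub, neg_mul, map_sub, map_neg, ← mul_assoc, e3, e4,
    tr_mul_comm C B, tr_mul_comm _ A]
  simp only [Complex.real_smul]
  push_cast
  ring

lemma fiberIntegral_chernSFam_two_two (n : ℕ) : fiberIntegral (chernSFam n) 2 2 = c22 n := by
  funext h
  by_cases hh : h ∈ GLpow n 2
  swap
  · simp [fiberIntegral, hh, c22]
  -- The integrand is constant in t, since only mixed curvatures survive next to the vanishing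
  -- vertical one; the factor 2 offsets the area 1/2 of the triangle.
  have key := fiberIntegral_eq_of_forall (p := 2) (q := 2) (chernSFam n) hh
    (fun _ => 1) ((2 : ℝ) • c22 n h) ?_
  · refine key.trans ?_
    rw [MeasureTheory.setIntegral_const, volume_simplex_two, smul_smul]
    norm_num
  intro t ht w
  refine (chernSFam_apply_sectionCurvature ht hh _).trans ?_
  change (2 : ℝ) • (chern2 n (sectionCurvature n 2 t h (Pi.single 0 1, 0) (Pi.single 1 1, 0)) _ -
    chern2 n (sectionCurvature n 2 t h (Pi.single 0 1, 0) (0, w 0))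
      (sectionCurvature n 2 t h (Pi.single 1 1, 0) (0, w 1)) +
    chern2 n (sectionCurvature n 2 t h (Pi.single 0 1, 0) (0, w 1))
      (sectionCurvature n 2 t h (Pi.single 1 1, 0) (0, w 0))) = _
  have e1 (k : Fin 2) : sectionCurvature n 2 t h (Pi.single 0 1, 0) (0, w k) =
      -(w k 0 * Ring.inverse (h 0)) :=
    (sectionCurvature_mixed t hh 0 (w k)).trans (sectionMC_one hh (w k))
  have e2 (k : Fin 2) : sectionCurvature n 2 t h (Pi.single 1 1, 0) (0, w k) =
      -((w k 0 * h 1 + h 0 * w k 1) * (Ring.inverse (h 1) * Ring.inverse (h 0))) :=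
    (sectionCurvature_mixed t hh 1 (w k)).trans (sectionMC_two hh (w k))
  have h0 (x : Mat n) : Ring.inverse (h 0) * (h 0 * x) = x := by
    rw [← mul_assoc, Ring.inverse_mul_cancel _ (hh 0), one_mul]
  have h1 (x : Mat n) : h 1 * (Ring.inverse (h 1) * x) = x := by
    rw [← mul_assoc, Ring.mul_inverse_cancel _ (hh 1), one_mul]
  have e3 (x : Mat n) : tr n (h 0 * (x * (Ring.inverse (h 1) * Ring.inverse (h 0)))) =
      tr n (Ring.inverse (h 1) * x) := by
    rw [tr_mul_comm, mul_assoc, mul_assoc, Ring.inverse_mul_cancel _ (hh 0), mul_one, tr_mul_comm]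
  have e4 (x : Mat n) : tr n (x * Ring.inverse (h 0)) = tr n (Ring.inverse (h 0) * x) :=
    tr_mul_comm _ _
  -- The term quadratic in dh_1 is symmetric in the two vectors, so it cancels in the
  -- antisymmetrised expression.
  have e5 : tr n (w 1 0 * (Ring.inverse (h 0) * (w 0 0 * Ring.inverse (h 0)))) =
      tr n (w 0 0 * (Ring.inverse (h 0) * (w 1 0 * Ring.inverse (h 0)))) := by
    rw [← mul_assoc, tr_mul_comm, mul_assoc]
  rw [ContinuousAlternatingMap.smul_apply, c22_apply hh]
  simp only [e1, e2, sectionCurvature_vertical t hh, map_zero, zero_apply]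
  simp only [chern2_apply]
  simp only [neg_mul_neg, add_mul, mul_add, map_neg, map_add, mul_assoc, h0, h1, e3, e4, e5, chernConst]
  simp only [Complex.real_smul]
  push_cast
  ring

lemma fiberIntegral_chernSFam (n : ℕ) : fiberIntegral (chernSFam n) = chernCochain n := by
  funext p q
  by_cases hpq : 4 = p + q
  swap
  · rw [(chernCochain_mem n).2 p q (Ne.symm hpq), fiberIntegral, dif_neg hpq]
  have hp : p ≤ 4 := by omega
  interval_cases p
  · obtain rfl : q = 4 := by omega
    exact fiberIntegral_chernSFam_zero_four n
  · obtain rfl : q = 3 := by omega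
    exact fiberIntegral_chernSFam_one_three n
  · obtain rfl : q = 2 := by omega
    exact fiberIntegral_chernSFam_two_two n
  · obtain rfl : q = 1 := by omega
    exact fiberIntegral_chernSFam_three_one n
  · obtain rfl : q = 0 := by omega
    exact fiberIntegral_chernSFam_four_zero n

end SimplicialDeRham

end

theorem mainTheorem6 (n : ℕ) :
    ∃ hc : SimplicialDeRham.chernCochain n ∈ SimplicialDeRham.Cocycle n 4,
      (SimplicialDeRham.dSecond n (SimplicialDeRham.chernCochain n) 1 4 = 0 ∧
        SimplicialDeRham.dPrime n (SimplicialDeRham.chernCochain n) 2 3 +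
          SimplicialDeRham.dSecond n (SimplicialDeRham.chernCochain n) 2 3 = 0 ∧
        SimplicialDeRham.dPrime n (SimplicialDeRham.chernCochain n) 3 2 = 0) ∧
      (∃! φ : SimplicialDeRham.SFam n 4,
        SimplicialDeRham.IsChernWeilForm (SimplicialDeRham.chern2 n) φ) ∧
      ∀ x : SimplicialDeRham.Cohomology n 4,
        SimplicialDeRham.IsChernWeilClass (SimplicialDeRham.chern2 n) x ↔
          x = SimplicialDeRham.cohClass hc := by
  have hφ := SimplicialDeRham.isChernWeilForm_chernSFam n
  have hI := SimplicialDeRham.fiberIntegral_chernSFam n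
  have hc := SimplicialDeRham.chernCochain_mem_cocycle n
  refine ⟨hc, ⟨SimplicialDeRham.dSecond_c13 n, SimplicialDeRham.dPrime_c13_add_dSecond_c22 n,
    SimplicialDeRham.dPrime_c22 n⟩, ⟨_, hφ, fun ψ hψ => hψ.eq hφ⟩, fun x => ⟨?_, ?_⟩⟩
  · rintro ⟨φ, h, hm, rfl⟩
    -- By uniqueness any representative of the Chern–Weil class is the form built from the section,
    -- whose integral is the explicit cochain itself.
    obtain rfl := h.eq hφ
    exact congrArg Submodule.Quotient.mk (Subtype.ext hI)
  · rintro rfl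
    exact ⟨_, hφ, hI.symm ▸ hc, congrArg Submodule.Quotient.mk (Subtype.ext hI.symm)⟩
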